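/- Let $n\ge 2$ and let $\mathbf k$ be $\mathbf R$, $\mathbf C$ or the quaternions $\mathbf H$. Let $G_{n,m}(\mathbf k)$ be the Grassmannian of $m$-dimensional subspaces of $\mathbf k^n$, with its standard structure of a smooth manifold. Topological embeddings $\iota_m:G_{n,m}(\mathbf k)\to\mathbf R^M$ ($1\le m\le n-1$) are said to be in general position if their images are pairwise disjoint, for every complete flag $V_1\subset V_2\subset\dots\subset V_{n-1}$ ($\dim V_m=m$) the points $\iota_1(V_1),\dots,\iota_{n-1}(V_{n-1})$ are affinely independent, and the simplices spanned by these points for any two complete flags intersect only along the face spanned by their common vertices. The flag join $\Theta_n(\mathbf k)\subset\mathbf R^M$ is the union of the simplices of all complete flags, with the topology induced from $\mathbf R^M$. Theorem 3.3 (strengthened Vassiljev theorem). For all sufficiently large $M$ there are smooth embeddings $G_{n,m}(\mathbf k)\to\mathbf R^M$ ($1\le m\le n-1$) in general position. For every $M$ and every family of embeddings in general position, the flag join $\Theta_n(\mathbf k)$ admits a smooth structure, compatible with its topology, in which it is diffeomorphic to the standard sphere $S^N$, where $$N=\frac{n(n-1)}2+n-2\ \ (\mathbf k=\mathbf R),\qquad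 N=n(n-1)+n-2\ \ (\mathbf k=\mathbf C),\qquad N=2n(n-1)+n-2\ \ (\mathbf k=\mathbf H),$$ and for which all the embeddings $G_{n,m}(\mathbf k)\hookrightarrow\Theta_n(\mathbf k)$, $V\mapsto\iota_m(V)$, $1\le m\le n-1$, are smooth embeddings (smooth immersions that are homeomorphisms onto their images). -/

import Mathlib

open Set Module
open scoped Manifold ContDiff Quaternion

noncomputable section

namespace FlagJoin

/-! ### Grassmannians over a finite-dimensional real division algebra

For a (possibly noncommutative) division ring `K`, subspaces of `Kⁿ` are left `K`-subspaces. -/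

/-- The Grassmannian `G_{n,m}(K)` of `m`-dimensional subspaces of `Kⁿ`. -/
def Gr (K : Type*) [DivisionRing K] (n m : ℕ) : Type _ :=
  {V : Submodule K (Fin n → K) // finrank K V = m}

section Algebra

variable {K : Type*} [DivisionRing K] {n m : ℕ}

/-- The rows of the `m × n` matrix `[1 | A]` with its columns permuted by `σ`: the columns
`σ (inl _)` carry the identity block and the columns `σ (inr _)` carry the block `A`. -/
def rows (σ : Fin m ⊕ Fin (n - m) ≃ Fin n) (A : Fin m → Fin (n - m) → K) (i : Fin m) :
    Fin n → K :=
  fun j => Sum.elim (Pi.single i 1) (A i) (σ.symm j)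

@[simp] lemma rows_inl (σ : Fin m ⊕ Fin (n - m) ≃ Fin n) (A : Fin m → Fin (n - m) → K)
    (i k : Fin m) : rows σ A i (σ (Sum.inl k)) = (Pi.single i 1 : Fin m → K) k := by
  simp [rows]

@[simp] lemma rows_inr (σ : Fin m ⊕ Fin (n - m) ≃ Fin n) (A : Fin m → Fin (n - m) → K)
    (i : Fin m) (j : Fin (n - m)) : rows σ A i (σ (Sum.inr j)) = A i j := by
  simp [rows]

lemma linearIndependent_rows (σ : Fin m ⊕ Fin (n - m) ≃ Fin n)
    (A : Fin m → Fin (n - m) → K) : LinearIndependent K (rows σ A) := by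
  rw [Fintype.linearIndependent_iff]
  intro g hg k
  have := congrFun hg (σ (Sum.inl k))
  simpa [Finset.sum_apply, Pi.single_apply] using this

/-- The point of the Grassmannian with affine coordinates `A`: the row space of `[1 | A]`, with
columns permuted by `σ`. -/
def ofMatrix (σ : Fin m ⊕ Fin (n - m) ≃ Fin n) (A : Fin m → Fin (n - m) → K) : Gr K n m :=
  ⟨Submodule.span K (range (rows σ A)), by
    rw [finrank_span_eq_card (linearIndependent_rows σ A), Fintype.card_fin]⟩

lemma mem_ofMatrix {σ : Fin m ⊕ Fin (n - m) ≃ Fin n} {A : Fin m → Fin (n - m) → K}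
    {x : Fin n → K} : x ∈ (ofMatrix σ A).1 ↔
      ∀ j, x (σ (Sum.inr j)) = ∑ i, x (σ (Sum.inl i)) * A i j := by
  rw [ofMatrix, Submodule.mem_span_range_iff_exists_fun]
  constructor
  · rintro ⟨c, rfl⟩ j
    simp [Finset.sum_apply, Pi.single_apply]
  · intro h
    refine ⟨fun i => x (σ (Sum.inl i)), ?_⟩
    funext j
    obtain ⟨j, rfl⟩ := σ.surjective j
    rcases j with j | j
    · simp [Finset.sum_apply, Pi.single_apply]
    · simp [Finset.sum_apply, h]

lemma rows_mem_ofMatrix (σ : Fin m ⊕ Fin (n - m) ≃ Fin n) (A : Fin m → Fin (n - m) → K)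
    (i : Fin m) : rows σ A i ∈ (ofMatrix σ A).1 :=
  Submodule.subset_span ⟨i, rfl⟩

lemma ofMatrix_injective (σ : Fin m ⊕ Fin (n - m) ≃ Fin n) :
    Function.Injective (ofMatrix (K := K) σ) := by
  intro A B h
  funext i j
  have h1 := rows_mem_ofMatrix σ A i
  rw [h, mem_ofMatrix] at h1
  simpa [Pi.single_apply] using h1 j

lemma ofMatrix_eq_iff {σ : Fin m ⊕ Fin (n - m) ≃ Fin n} {A : Fin m → Fin (n - m) → K}
    {V : Gr K n m} : ofMatrix σ A = V ↔ ∀ i, rows σ A i ∈ V.1 := by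
  constructor
  · rintro rfl i
    exact rows_mem_ofMatrix σ A i
  · intro h
    apply Subtype.ext
    apply Submodule.eq_of_le_of_finrank_eq
    · exact Submodule.span_le.2 (by rintro _ ⟨i, rfl⟩; exact h i)
    · rw [(ofMatrix σ A).2, V.2]

/-- Every subspace has affine coordinates with respect to some choice of pivot columns. -/
lemma exists_ofMatrix_eq (V : Gr K n m) : ∃ (σ : Fin m ⊕ Fin (n - m) ≃ Fin n)
    (A : Fin m → Fin (n - m) → K), ofMatrix σ A = V := by
  have hmn : m ≤ n := by
    have := Submodule.finrank_le V.1
    rw [V.2] at this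
    simpa using this
  let v : Fin n → (Fin n → K) ⧸ V.1 := fun i => V.1.mkQ (Pi.single i 1)
  obtain ⟨κ, a, ha, hspan, hli⟩ := exists_linearIndependent' K v
  have : Finite κ := Finite.of_injective a ha
  have : Fintype κ := Fintype.ofFinite κ
  have htop : Submodule.span K (range v) = ⊤ := by
    have : range v = V.1.mkQ '' range (fun i : Fin n => (Pi.single i 1 : Fin n → K)) := by
      rw [← range_comp]; rfl
    rw [this, Submodule.span_image]
    have h2 : Submodule.span K (range (fun i : Fin n => (Pi.single i 1 : Fin n → K))) = ⊤ := by
      have := (Pi.basisFun K (Fin n)).span_eq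
      convert this using 3
      funext i
      simp
    rw [h2, Submodule.map_top, Submodule.range_mkQ]
  have hcard : Fintype.card κ = n - m := by
    have h1 := finrank_span_eq_card hli
    rw [hspan, htop, finrank_top] at h1
    have h2 := V.1.finrank_quotient_add_finrank
    rw [V.2] at h2
    simp only [finrank_fin_fun] at h2
    omega
  let e2 : Fin (n - m) ≃ range a :=
    (Fintype.equivFinOfCardEq hcard).symm.trans (Equiv.ofInjective a ha)
  have hc2 : Nat.card ((range a)ᶜ : Set (Fin n)) = m := by
    have h3 : Nat.card (range a) = n - m := by
      rw [← Nat.card_congr e2]; simp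
    have := Set.ncard_add_ncard_compl (range a)
    simp only [← Nat.card_coe_set_eq, Nat.card_fin] at this
    omega
  let e1 : Fin m ≃ ((range a)ᶜ : Set (Fin n)) := (Finite.equivFinOfCardEq hc2).symm
  classical
  let σ : Fin m ⊕ Fin (n - m) ≃ Fin n :=
    (Equiv.sumComm _ _).trans ((Equiv.sumCongr e2 e1).trans (Equiv.Set.sumCompl (range a)))
  have hσ : ∀ j, σ (Sum.inr j) = (e2 j : Fin n) := fun j => by simp [σ]
  have key : ∀ i : Fin m, ∃ c : Fin (n - m) → K,
      ∑ j, c j • v (σ (Sum.inr j)) = v (σ (Sum.inl i)) := by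
    intro i
    have h4 : v (σ (Sum.inl i)) ∈ Submodule.span K (range fun j => v (σ (Sum.inr j))) := by
      have h5 : (range fun j => v (σ (Sum.inr j))) = range (v ∘ a) := by
        ext x
        constructor
        · rintro ⟨j, rfl⟩
          obtain ⟨k, hk⟩ := (e2 j).2
          exact ⟨k, by simp [hσ, hk]⟩
        · rintro ⟨k, rfl⟩
          refine ⟨e2.symm ⟨a k, k, rfl⟩, ?_⟩
          simp [hσ]
      rw [h5, hspan, htop]
      trivial
    exact (Submodule.mem_span_range_iff_exists_fun K).1 h4
  choose c hc using key
  refine ⟨σ, fun i j => - c i j, ofMatrix_eq_iff.2 fun i => ?_⟩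
  rw [← Submodule.Quotient.mk_eq_zero, ← Submodule.mkQ_apply]
  have h6 : rows σ (fun i j => - c i j) i =
      Pi.single (σ (Sum.inl i)) 1 - ∑ j, c i j • Pi.single (σ (Sum.inr j)) 1 := by
    funext j
    obtain ⟨j, rfl⟩ := σ.surjective j
    rcases j with j | j
    · simp [Pi.single_apply, Finset.sum_apply]
    · simp [Pi.single_apply, Finset.sum_apply]
  rw [h6, map_sub, map_sum]
  simp only [map_smul]
  exact sub_eq_zero.2 (hc i).symm

/-- The affine chart of the Grassmannian with pivot columns `σ (inl _)`: it sends the row space of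
`[1 | A]` (columns permuted by `σ`) to `A`, and its target is the whole space of matrices. -/
def affineChart (σ : Fin m ⊕ Fin (n - m) ≃ Fin n) :
    PartialEquiv (Gr K n m) (Fin m → Fin (n - m) → K) where
  toFun := Function.invFun (ofMatrix σ)
  invFun := ofMatrix σ
  source := range (ofMatrix σ)
  target := univ
  map_source' _ _ := mem_univ _
  map_target' A _ := mem_range_self A
  left_inv' := by
    rintro _ ⟨A, rfl⟩
    rw [Function.leftInverse_invFun (ofMatrix_injective σ)]
  right_inv' A _ := Function.leftInverse_invFun (ofMatrix_injective σ) A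

/-- The submatrix of `[1 | A]` (columns permuted by `σ`) on the columns `τ (inl _)`. -/
def pivotBlock (σ τ : Fin m ⊕ Fin (n - m) ≃ Fin n) (A : Fin m → Fin (n - m) → K) :
    Matrix (Fin m) (Fin m) K :=
  Matrix.of fun i k => rows σ A i (τ (Sum.inl k))

lemma ofMatrix_eq_ofMatrix_of_isUnit {σ τ : Fin m ⊕ Fin (n - m) ≃ Fin n}
    {A : Fin m → Fin (n - m) → K} (h : IsUnit (pivotBlock σ τ A)) :
    ofMatrix τ (fun k j => ∑ i, Ring.inverse (pivotBlock σ τ A) k i *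
      rows σ A i (τ (Sum.inr j))) = ofMatrix σ A := by
  symm
  rw [ofMatrix_eq_iff]
  intro i
  rw [mem_ofMatrix]
  intro j
  have h1 := Ring.mul_inverse_cancel _ h
  have h2 : (pivotBlock σ τ A * (Ring.inverse (pivotBlock σ τ A) *
      (Matrix.of fun i j => rows σ A i (τ (Sum.inr j)) : Matrix (Fin m) (Fin (n - m)) K))) i j
      = rows σ A i (τ (Sum.inr j)) := by
    rw [← Matrix.mul_assoc, h1, Matrix.one_mul]; rfl
  rw [← h2, Matrix.mul_apply]
  rfl

lemma isUnit_pivotBlock_iff {σ τ : Fin m ⊕ Fin (n - m) ≃ Fin n}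
    {A : Fin m → Fin (n - m) → K} :
    IsUnit (pivotBlock σ τ A) ↔ ofMatrix σ A ∈ range (ofMatrix (K := K) τ) := by
  constructor
  · intro h
    exact ⟨_, ofMatrix_eq_ofMatrix_of_isUnit h⟩
  · rintro ⟨B, hB⟩
    have h1 : ∀ k, ∃ c : Fin m → K, ∑ i, c i • rows σ A i = rows τ B k := fun k => by
      have := rows_mem_ofMatrix τ B k
      rw [hB, ofMatrix, Submodule.mem_span_range_iff_exists_fun] at this
      exact this
    choose c hc using h1
    have h2 : Matrix.of c * pivotBlock σ τ A = 1 := by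
      ext k l
      have := congrFun (hc k) (τ (Sum.inl l))
      simp only [Finset.sum_apply, Pi.smul_apply, smul_eq_mul, rows_inl] at this
      rw [Matrix.mul_apply, Matrix.one_apply]
      simp only [pivotBlock, Matrix.of_apply]
      rw [this, Pi.single_apply]
      simp [eq_comm]
    exact ⟨⟨pivotBlock σ τ A, Matrix.of c, mul_eq_one_comm.1 h2, h2⟩, rfl⟩

lemma affineChart_symm_trans_source (σ τ : Fin m ⊕ Fin (n - m) ≃ Fin n) :
    ((affineChart (K := K) σ).symm.trans (affineChart τ)).source =
      {A | IsUnit (pivotBlock σ τ A)} := by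
  ext A
  rw [mem_ofPred_eq, isUnit_pivotBlock_iff]
  simp [affineChart, PartialEquiv.trans_source]

lemma affineChart_symm_trans_apply {σ τ : Fin m ⊕ Fin (n - m) ≃ Fin n}
    {A : Fin m → Fin (n - m) → K} (h : IsUnit (pivotBlock σ τ A)) :
    (affineChart (K := K) σ).symm.trans (affineChart τ) A =
      fun k j => ∑ i, Ring.inverse (pivotBlock σ τ A) k i * rows σ A i (τ (Sum.inr j)) := by
  change Function.invFun (ofMatrix τ) (ofMatrix σ A) = _
  rw [← ofMatrix_eq_ofMatrix_of_isUnit h,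
    Function.leftInverse_invFun (ofMatrix_injective τ)]

end Algebra

section Smooth

variable {K : Type*} [NormedDivisionRing K] [NormedAlgebra ℝ K] {n m : ℕ}

lemma contDiff_rows (σ : Fin m ⊕ Fin (n - m) ≃ Fin n) (i : Fin m) (j : Fin n) :
    ContDiff ℝ ∞ (fun A : Fin m → Fin (n - m) → K => rows σ A i j) := by
  obtain ⟨j, rfl⟩ := σ.surjective j
  rcases j with j | j
  · simp only [rows_inl]; exact contDiff_const
  · simp only [rows_inr]; fun_prop

variable [FiniteDimensional ℝ K]

attribute [local instance] Matrix.linftyOpNormedRing Matrix.linftyOpNormedAlgebra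

lemma contDiff_pivotBlock (σ τ : Fin m ⊕ Fin (n - m) ≃ Fin n) :
    ContDiff ℝ ∞ (pivotBlock (K := K) σ τ) := by
  let L : (Fin m → Fin m → K) →ₗ[ℝ] Matrix (Fin m) (Fin m) K :=
    { toFun := Matrix.of, map_add' := fun _ _ => rfl, map_smul' := fun _ _ => rfl }
  have hL : ContDiff ℝ ∞ L := L.toContinuousLinearMap.contDiff
  have hr : ContDiff ℝ ∞ (fun (A : Fin m → Fin (n - m) → K) (i k : Fin m) =>
      rows σ A i (τ (Sum.inl k))) :=
    contDiff_pi.2 fun i => contDiff_pi.2 fun k => contDiff_rows σ i _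
  exact hL.comp hr

lemma isOpen_isUnit_pivotBlock (σ τ : Fin m ⊕ Fin (n - m) ≃ Fin n) :
    IsOpen {A : Fin m → Fin (n - m) → K | IsUnit (pivotBlock σ τ A)} := by
  have : CompleteSpace (Matrix (Fin m) (Fin m) K) := FiniteDimensional.complete ℝ _
  exact (Units.isOpen (R := Matrix (Fin m) (Fin m) K)).preimage
    (contDiff_pivotBlock (K := K) σ τ).continuous

lemma contDiffOn_affineChart (σ τ : Fin m ⊕ Fin (n - m) ≃ Fin n) :
    ContDiffOn ℝ ∞ ((affineChart (K := K) σ).symm.trans (affineChart τ))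
      ((affineChart (K := K) σ).symm.trans (affineChart τ)).source := by
  rw [affineChart_symm_trans_source]
  have : CompleteSpace (Matrix (Fin m) (Fin m) K) := FiniteDimensional.complete ℝ _
  have h : ContDiffOn ℝ ∞ (fun A : Fin m → Fin (n - m) → K => fun k j => ∑ i,
      Ring.inverse (pivotBlock σ τ A) k i * rows σ A i (τ (Sum.inr j)))
      {A | IsUnit (pivotBlock σ τ A)} := by
    refine contDiffOn_pi.2 fun k => contDiffOn_pi.2 fun j => ContDiffOn.sum fun i _ => ?_
    refine ContDiffOn.mul ?_ (contDiff_rows σ i _).contDiffOn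
    let L : Matrix (Fin m) (Fin m) K →ₗ[ℝ] K :=
      { toFun := fun M => M k i, map_add' := fun _ _ => rfl, map_smul' := fun _ _ => rfl }
    have hL : ContDiff ℝ ∞ L := L.toContinuousLinearMap.contDiff
    have hinv : ContDiffOn ℝ ∞ (fun A => Ring.inverse (pivotBlock (K := K) σ τ A))
        {A | IsUnit (pivotBlock σ τ A)} := by
      rintro A ⟨u, hu⟩
      have h1 : ContDiffAt ℝ ∞ Ring.inverse (pivotBlock σ τ A) := hu ▸ contDiffAt_ringInverse ℝ u
      exact (h1.comp A (contDiff_pivotBlock σ τ).contDiffAt).contDiffWithinAt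
    exact hL.comp_contDiffOn hinv
  exact h.congr fun A hA => affineChart_symm_trans_apply hA

end Smooth

section Manifold

variable (K : Type*) [NormedDivisionRing K] [NormedAlgebra ℝ K] [FiniteDimensional ℝ K]
  (n m : ℕ)

/-- The standard atlas of the Grassmannian, consisting of all the affine charts. -/
def grCore : ChartedSpaceCore (Fin m → Fin (n - m) → K) (Gr K n m) where
  atlas := range affineChart
  chartAt V := affineChart (exists_ofMatrix_eq V).choose
  mem_chart_source V := (exists_ofMatrix_eq V).choose_spec
  chart_mem_atlas V := mem_range_self _
  open_source := by
    rintro _ _ ⟨σ, rfl⟩ ⟨τ, rfl⟩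
    rw [affineChart_symm_trans_source]
    exact isOpen_isUnit_pivotBlock σ τ
  continuousOn_toFun := by
    rintro _ _ ⟨σ, rfl⟩ ⟨τ, rfl⟩
    exact (contDiffOn_affineChart σ τ).continuousOn

/-- The manifold topology of the Grassmannian. -/
instance : TopologicalSpace (Gr K n m) := (grCore K n m).toTopologicalSpace

instance : ChartedSpace (Fin m → Fin (n - m) → K) (Gr K n m) := (grCore K n m).toChartedSpace

/-- The Grassmannian is a smooth manifold. -/
instance : IsManifold 𝓘(ℝ, Fin m → Fin (n - m) → K) ∞ (Gr K n m) := by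
  apply isManifold_of_contDiffOn
  intro e e' he he'
  change e ∈ ⋃ (c : PartialEquiv _ _) (hc : c ∈ (grCore K n m).atlas),
    {(grCore K n m).openPartialHomeomorph c hc} at he
  change e' ∈ ⋃ (c : PartialEquiv _ _) (hc : c ∈ (grCore K n m).atlas),
    {(grCore K n m).openPartialHomeomorph c hc} at he'
  simp only [mem_iUnion, mem_singleton_iff] at he he'
  obtain ⟨_, ⟨σ, rfl⟩, rfl⟩ := he
  obtain ⟨_, ⟨τ, rfl⟩, rfl⟩ := he'
  simpa using! contDiffOn_affineChart (K := K) σ τ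

end Manifold

/-! ### The flag join -/

/-- A smooth embedding: a smooth immersion which is a homeomorphism onto its image. -/
def IsSmoothEmbedding (E E' : Type*) {M M' : Type*} [NormedAddCommGroup E] [NormedSpace ℝ E]
    [NormedAddCommGroup E'] [NormedSpace ℝ E'] [TopologicalSpace M] [ChartedSpace E M]
    [TopologicalSpace M'] [ChartedSpace E' M'] (f : M → M') : Prop :=
  ContMDiff 𝓘(ℝ, E) 𝓘(ℝ, E') ∞ f ∧
    (∀ x, Function.Injective (mfderiv 𝓘(ℝ, E) 𝓘(ℝ, E') f x)) ∧ Topology.IsEmbedding f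

/-- A complete flag `V₁ ⊂ V₂ ⊂ ⋯ ⊂ V_{n-1}` of proper nonzero subspaces of `Kⁿ`; the entry with
index `i` is the subspace of dimension `i + 1`. -/
structure CompleteFlag (K : Type*) [DivisionRing K] (n : ℕ) where
  space : ∀ i : Fin (n - 1), Gr K n (i + 1)
  mono : ∀ i j, i ≤ j → (space i).1 ≤ (space j).1

/-- Every proper nonzero subspace belongs to a complete flag. -/
lemma exists_completeFlag {K : Type*} [DivisionRing K] {n : ℕ} (i : Fin (n - 1))
    (V : Gr K n (i + 1)) : ∃ F : CompleteFlag K n, F.space i = V := by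
  obtain ⟨W, hW⟩ := V.1.exists_isCompl
  have hsum := Submodule.finrank_add_eq_of_isCompl hW
  rw [V.2, finrank_fin_fun] at hsum
  let b₀ := ((finBasisOfFinrankEq K V.1 V.2).prod (finBasis K W)).map
    (Submodule.prodEquivOfIsCompl V.1 W hW)
  let b : Basis (Fin n) K (Fin n → K) := b₀.reindex (finSumFinEquiv.trans (finCongr hsum))
  have hV : ∀ k : Fin n, (k : ℕ) < i + 1 → b k ∈ V.1 := by
    intro k hk
    have h1 : (finSumFinEquiv.trans (finCongr hsum)).symm k = Sum.inl ⟨k, hk⟩ := by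
      rw [Equiv.symm_apply_eq]
      ext
      simp
    simp only [b, Basis.reindex_apply, h1]
    simp [b₀]
  have hrank : ∀ j : Fin (n - 1),
      finrank K (Submodule.span K (b '' {k | (k : ℕ) < j + 1})) = j + 1 := by
    intro j
    have hj : (j : ℕ) + 1 ≤ n := by omega
    have h2 : b '' {k | (k : ℕ) < j + 1} = range (b ∘ Fin.castLE hj) := by
      rw [range_comp]
      congr 1
      ext k
      constructor
      · intro hk
        exact ⟨⟨k, hk⟩, by ext; simp⟩
      · rintro ⟨l, rfl⟩
        exact l.2
    rw [h2, finrank_span_eq_card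
      (b.linearIndependent.comp _ (Fin.castLE_injective hj)), Fintype.card_fin]
  refine ⟨⟨fun j => ⟨Submodule.span K (b '' {k | (k : ℕ) < j + 1}), hrank j⟩, ?_⟩, ?_⟩
  · intro j l hjl
    refine Submodule.span_mono (image_mono fun k hk => ?_)
    have h3 : (k : ℕ) < j + 1 := hk
    have h4 : (j : ℕ) ≤ l := hjl
    change (k : ℕ) < l + 1
    omega
  · apply Subtype.ext
    apply Submodule.eq_of_le_of_finrank_eq
    · refine Submodule.span_le.2 ?_
      rintro _ ⟨k, hk, rfl⟩
      exact hV k hk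
    · rw [V.2]
      exact hrank i

section Join

variable {K : Type*} [NormedDivisionRing K] [NormedAlgebra ℝ K] [FiniteDimensional ℝ K]
  {n M : ℕ}

/-- The vertices of the simplex of a complete flag. -/
def vertices (ι : ∀ i : Fin (n - 1), Gr K n (i + 1) → EuclideanSpace ℝ (Fin M))
    (F : CompleteFlag K n) : Set (EuclideanSpace ℝ (Fin M)) :=
  range fun i => ι i (F.space i)

/-- Embeddings `ι` of the Grassmannians `G_{n,1}(K), …, G_{n,n-1}(K)` into `ℝ^M` are in general
position if their images are disjoint, the vertices of every complete flag span a nondegenerate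
simplex, and any two of these simplices meet only along the face spanned by their common
vertices. -/
structure GeneralPosition
    (ι : ∀ i : Fin (n - 1), Gr K n (i + 1) → EuclideanSpace ℝ (Fin M)) : Prop where
  isEmbedding : ∀ i, Topology.IsEmbedding (ι i)
  disjoint : ∀ i j, i ≠ j → Disjoint (range (ι i)) (range (ι j))
  affineIndependent : ∀ F : CompleteFlag K n,
    AffineIndependent ℝ fun i => ι i (F.space i)
  inter_subset : ∀ F F' : CompleteFlag K n,
    convexHull ℝ (vertices ι F) ∩ convexHull ℝ (vertices ι F') ⊆
      convexHull ℝ (vertices ι F ∩ vertices ι F')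

/-- The flag join `Θ_n(K)`: the union of the simplices of all complete flags. It carries the
topology induced from `ℝ^M`. -/
def flagJoin (ι : ∀ i : Fin (n - 1), Gr K n (i + 1) → EuclideanSpace ℝ (Fin M)) :
    Set (EuclideanSpace ℝ (Fin M)) :=
  ⋃ F : CompleteFlag K n, convexHull ℝ (vertices ι F)

/-- The embedding of the Grassmannian `G_{n,i+1}(K)` into the flag join. -/
def grEmbedding (ι : ∀ i : Fin (n - 1), Gr K n (i + 1) → EuclideanSpace ℝ (Fin M))
    (i : Fin (n - 1)) (V : Gr K n (i + 1)) : flagJoin ι :=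
  ⟨ι i V, by
    obtain ⟨F, hF⟩ := exists_completeFlag i V
    exact mem_iUnion.2 ⟨F, subset_convexHull ℝ _ ⟨i, by simp [hF]⟩⟩⟩

/-- The flag join admits a smooth structure (compatible with its topology) which makes it
diffeomorphic to the standard sphere `S^N` and all the maps `G_{n,m}(K) → Θ_n(K)` smooth
embeddings. -/
def HasStandardSphereStructure
    (ι : ∀ i : Fin (n - 1), Gr K n (i + 1) → EuclideanSpace ℝ (Fin M)) (N : ℕ) : Prop :=
  ∃ _ : ChartedSpace (EuclideanSpace ℝ (Fin N)) (flagJoin ι),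
    IsManifold (𝓡 N) ∞ (flagJoin ι) ∧
    Nonempty (flagJoin ι ≃ₘ⟮𝓡 N, 𝓡 N⟯
      Metric.sphere (0 : EuclideanSpace ℝ (Fin (N + 1))) 1) ∧
    ∀ i : Fin (n - 1), IsSmoothEmbedding (Fin (i + 1) → Fin (n - (i + 1)) → K) (EuclideanSpace ℝ (Fin N))
      (grEmbedding ι i)

end Join

/-- The Grassmannians over `K` can be smoothly embedded in general position into every Euclidean
space of sufficiently large dimension, and for all embeddings in general position the flag join
has the smooth structure of the standard sphere `S^N` with the Grassmannians smoothly embedded. -/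
def FlagJoinIsSmoothSphere (K : Type*) [NormedDivisionRing K] [NormedAlgebra ℝ K]
    [FiniteDimensional ℝ K] (n N : ℕ) : Prop :=
  (∃ M₀ : ℕ, ∀ M ≥ M₀, ∃ ι : ∀ i : Fin (n - 1), Gr K n (i + 1) → EuclideanSpace ℝ (Fin M),
    GeneralPosition ι ∧ ∀ i : Fin (n - 1), IsSmoothEmbedding (Fin (i + 1) → Fin (n - (i + 1)) → K)
      (EuclideanSpace ℝ (Fin M)) (ι i)) ∧
  ∀ (M : ℕ) (ι : ∀ i : Fin (n - 1), Gr K n (i + 1) → EuclideanSpace ℝ (Fin M)),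
    GeneralPosition ι → HasStandardSphereStructure ι N

end FlagJoin

end

set_option linter.unusedSectionVars false

namespace FlagJoin

noncomputable section

open Matrix Topology Filter

/-! The sphere in question is the unit sphere of the real inner product space of traceless Hermitian
`n × n` matrices over `K`, with inner product the real part of `tr (AB)`. By the spectral theorem, a
Hermitian matrix with ordered eigenvalues `l₀ ≥ l₁ ≥ …` is `∑ tᵢ Pᵢ + c`, where `Pᵢ` projects onto
the span of the first `i + 1` eigenvectors and `tᵢ = lᵢ - lᵢ₊₁ ≥ 0` are the eigenvalue gaps
(`exists_flag_sum_smul_proj`). Conversely the matrix determines the gaps, and it determines each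
subspace whose gap is nonzero (`eq_of_sum_smul_proj_eq`). The latter rests on one inequality: the
real trace of `P_V P_W` is at most `min (dim V) (dim W)`, and it equals `dim V` only if `V ≤ W`.

Weighted flags therefore map onto the sphere, and two of them have the same image exactly when they
have equal weights and agree wherever the weight is nonzero. General position says that the map from
weighted flags to the flag join has the same fibres. The space of weighted flags is compact and both
targets are Hausdorff, so both maps are quotient maps and the flag join is homeomorphic to the
sphere (`GeneralPosition.exists_homeomorph_sphere`). The smooth structure is pulled back along this
homeomorphism.

Under it a Grassmannian becomes `V ↦ P_V - (m/n)`, divided by its norm. That norm depends only on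
`m` and `n`, so an affine map recovers `P_V`, and everything reduces to `V ↦ P_V` being a smooth
embedding (`isSmoothEmbedding_projFun`). Injective linear images of the maps `V ↦ P_V` also supply
the smooth embeddings in general position. Only the few properties of `K` listed in
`HermitianAlgebra` are used, so the three cases are treated together. -/

/-- A normed division algebra over `ℝ` with a conjugation, whose self-conjugate elements are the
reals. -/
class HermitianAlgebra (K : Type*) [NormedDivisionRing K] [NormedAlgebra ℝ K] [StarRing K] where
  /-- The real part. -/
  re : K →ₗ[ℝ] ℝ
  re_one : re 1 = 1
  re_mul_comm : ∀ a b, re (a * b) = re (b * a)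
  re_star : ∀ a, re (star a) = re a
  mul_star_self : ∀ a : K, a * star a = algebraMap ℝ K (‖a‖ ^ 2)
  star_algebraMap : ∀ r : ℝ, star (algebraMap ℝ K r) = algebraMap ℝ K r
  eq_algebraMap_of_star_eq : ∀ a : K, star a = a → a = algebraMap ℝ K (re a)

open HermitianAlgebra

instance : HermitianAlgebra ℝ where
  re := LinearMap.id
  re_one := rfl
  re_mul_comm := mul_comm
  re_star _ := rfl
  mul_star_self a := by simp [sq]
  star_algebraMap _ := rfl
  eq_algebraMap_of_star_eq _ _ := rfl

instance : HermitianAlgebra ℂ where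
  re := Complex.reLm
  re_one := by simp
  re_mul_comm a b := by simp [mul_comm]
  re_star a := by simp
  mul_star_self a := by simp [Complex.mul_conj, Complex.normSq_eq_norm_sq]
  star_algebraMap r := by simp
  eq_algebraMap_of_star_eq a h := by
    simpa using (Complex.conj_eq_iff_re.1 h).symm

instance : HermitianAlgebra ℍ[ℝ] where
  re :=
    { toFun := fun a => a.re
      map_add' := fun _ _ => rfl
      map_smul' := fun _ _ => rfl }
  re_one := rfl
  re_mul_comm a b := by
    change (a * b).re = (b * a).re
    simp only [Quaternion.re_mul]; ring
  re_star a := Quaternion.re_star a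
  mul_star_self a := by
    rw [Quaternion.self_mul_star, Quaternion.normSq_eq_norm_mul_self, sq]; rfl
  star_algebraMap r := by
    exact Quaternion.star_coe r
  eq_algebraMap_of_star_eq a h := by
    exact Quaternion.star_eq_self.1 h

/-! ### The real trace form on matrices -/

section Forms

variable {K : Type*} [NormedDivisionRing K] [NormedAlgebra ℝ K] [StarRing K] [HermitianAlgebra K]

lemma re_algebraMap (r : ℝ) : re (algebraMap ℝ K r) = r := by
  rw [Algebra.algebraMap_eq_smul_one, map_smul, re_one, smul_eq_mul, mul_one]

instance : StarModule ℝ K where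
  star_smul r a := by
    rw [Algebra.smul_def, star_mul, star_algebraMap, ← Algebra.commutes, Algebra.smul_def]
    rfl

lemma re_mul_star_self (a : K) : re (a * star a) = ‖a‖ ^ 2 := by
  rw [mul_star_self, re_algebraMap]

variable {m n : Type*} [Fintype m] [Fintype n]

/-- The real part of the trace. -/
def retr : Matrix n n K →ₗ[ℝ] ℝ := re ∘ₗ Matrix.traceLinearMap n ℝ K

lemma retr_apply (A : Matrix n n K) : retr A = ∑ i, re (A i i) := by
  simp [retr, Matrix.trace]

/-- The trace itself is not cyclic over a noncommutative `K`; its real part is, and this is why the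
real trace is used throughout. -/
lemma retr_mul_comm (A : Matrix m n K) (B : Matrix n m K) : retr (A * B) = retr (B * A) := by
  simp only [retr_apply, Matrix.mul_apply, map_sum]
  rw [Finset.sum_comm]
  simp only [re_mul_comm]

lemma retr_mul_conjTranspose (A : Matrix m n K) : retr (A * Aᴴ) = ∑ i, ∑ j, ‖A i j‖ ^ 2 := by
  simp [retr_apply, Matrix.mul_apply, re_mul_star_self]

lemma retr_mul_conjTranspose_nonneg (A : Matrix m n K) : 0 ≤ retr (A * Aᴴ) := by
  rw [retr_mul_conjTranspose]; positivity

lemma eq_zero_of_retr_mul_conjTranspose {A : Matrix m n K} (h : retr (A * Aᴴ) = 0) : A = 0 := by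
  rw [retr_mul_conjTranspose, Finset.sum_eq_zero_iff_of_nonneg fun _ _ => by positivity] at h
  ext i j
  have := h i (Finset.mem_univ _)
  rw [Finset.sum_eq_zero_iff_of_nonneg fun _ _ => by positivity] at this
  simpa using this j (Finset.mem_univ _)

lemma retr_one [DecidableEq n] : retr (1 : Matrix n n K) = Fintype.card n := by
  simp [retr_apply, re_one]

end Forms

/-! ### Linear algebra over `ℝ` with a positive definite form -/

section RealForms

variable {V : Type*} [AddCommGroup V] [Module ℝ V]

/-- The inner product of a positive definite symmetric bilinear form. -/
@[reducible] def innerCore (B : V →ₗ[ℝ] V →ₗ[ℝ] ℝ) (hB : ∀ x y, B x y = B y x)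
    (hpos : ∀ x, 0 ≤ B x x) (hdef : ∀ x, B x x = 0 → x = 0) : InnerProductSpace.Core ℝ V where
  inner x y := B x y
  conj_inner_symm x y := hB y x
  re_inner_nonneg := hpos
  add_left x y z := by simp
  smul_left x y r := by simp
  definite := hdef

/-- Working with real symmetric operators covers the quaternions without a theory of quaternionic
inner products, and makes the eigenvalues real from the start. -/
lemma exists_eigenvector_of_form [FiniteDimensional ℝ V] [Nontrivial V]
    (B : V →ₗ[ℝ] V →ₗ[ℝ] ℝ) (hB : ∀ x y, B x y = B y x)
    (hpos : ∀ x, 0 ≤ B x x) (hdef : ∀ x, B x x = 0 → x = 0)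
    (T : V →ₗ[ℝ] V) (hT : ∀ x y, B (T x) y = B x (T y)) :
    ∃ (μ : ℝ) (v : V), v ≠ 0 ∧ T v = μ • v := by
  let c := innerCore B hB hpos hdef
  let : NormedAddCommGroup V := @InnerProductSpace.Core.toNormedAddCommGroup ℝ V _ _ _ c
  let : InnerProductSpace ℝ V := InnerProductSpace.ofCore c.toCore
  have hs : T.IsSymmetric := hT
  by_contra hcon
  push Not at hcon
  have := hs.subsingleton_of_no_eigenvalue_finiteDimensional fun μ => by
    rw [Submodule.eq_bot_iff]
    intro v hv
    by_contra hv0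
    exact hcon μ v hv0 (Module.End.mem_eigenspace_iff.1 hv)
  exact not_subsingleton V this

lemma exists_linearEquiv_euclideanSpace [FiniteDimensional ℝ V] {d : ℕ} (hd : finrank ℝ V = d)
    (B : V →ₗ[ℝ] V →ₗ[ℝ] ℝ) (hB : ∀ x y, B x y = B y x)
    (hpos : ∀ x, 0 ≤ B x x) (hdef : ∀ x, B x x = 0 → x = 0) :
    ∃ e : V ≃ₗ[ℝ] EuclideanSpace ℝ (Fin d), ∀ x, ‖e x‖ ^ 2 = B x x := by
  let c := innerCore B hB hpos hdef
  let : NormedAddCommGroup V := @InnerProductSpace.Core.toNormedAddCommGroup ℝ V _ _ _ c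
  let : InnerProductSpace ℝ V := InnerProductSpace.ofCore c.toCore
  subst hd
  refine ⟨(stdOrthonormalBasis ℝ V).repr.toLinearEquiv, fun x => ?_⟩
  simp only [LinearIsometryEquiv.coe_toLinearEquiv, LinearIsometryEquiv.norm_map]
  exact (real_inner_self_eq_norm_sq x).symm

end RealForms

/-! ### Orthogonal projections -/

section Projections

variable {K : Type*} [NormedDivisionRing K] [StarRing K] {n : ℕ}

/-- The matrix `Q`, acting on row vectors from the right, is the orthogonal projection onto `V`. -/
structure IsOrthProj (V : Submodule K (Fin n → K)) (Q : Matrix (Fin n) (Fin n) K) : Prop where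
  conjTranspose_eq : Qᴴ = Q
  mem : ∀ x, x ᵥ* Q ∈ V
  fix : ∀ x ∈ V, x ᵥ* Q = x

namespace IsOrthProj

variable {V W : Submodule K (Fin n → K)} {P Q : Matrix (Fin n) (Fin n) K}

lemma mul_eq_left (hQ : IsOrthProj W Q) (h : ∀ x, x ᵥ* P ∈ W) : P * Q = P := by
  refine Matrix.ext_of_single_vecMul fun i => ?_
  rw [← Matrix.vecMul_vecMul]
  exact hQ.fix _ (h _)

lemma mul_eq_left_iff (hP : IsOrthProj V P) (hQ : IsOrthProj W Q) : P * Q = P ↔ V ≤ W := by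
  refine ⟨fun h x hx => ?_, fun h => hQ.mul_eq_left fun x => h (hP.mem x)⟩
  rw [← hP.fix x hx, ← h, ← Matrix.vecMul_vecMul]
  exact hQ.mem _

lemma mul_self (hQ : IsOrthProj V Q) : Q * Q = Q := hQ.mul_eq_left hQ.mem

/-- Each projection fixes the image of the other, so `PQ = P` and `QP = Q`; the conjugate transpose
of the second relation is `PQ = Q`. -/
lemma eq (hP : IsOrthProj V P) (hQ : IsOrthProj V Q) : P = Q := by
  have h1 := (hP.mul_eq_left_iff hQ).2 le_rfl
  have h2 := (hQ.mul_eq_left_iff hP).2 le_rfl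
  have h3 := congrArg conjTranspose h2
  rw [conjTranspose_mul, hP.conjTranspose_eq, hQ.conjTranspose_eq] at h3
  exact h1.symm.trans h3

end IsOrthProj

end Projections

/-! ### Projections in affine coordinates, and the trace inequality -/

section Gram

variable {K : Type*} [NormedDivisionRing K] [NormedAlgebra ℝ K] [FiniteDimensional ℝ K]
  [StarRing K] [HermitianAlgebra K] {n m : ℕ}

/-- Right multiplication by `G` is an injective real-linear endomorphism of a finite-dimensional
space, hence surjective, and a one-sided inverse of a square matrix is two-sided. No determinant is
needed. -/
lemma isUnit_of_mul_eq_zero {G : Matrix (Fin m) (Fin m) K}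
    (h : ∀ M : Matrix (Fin m) (Fin m) K, M * G = 0 → M = 0) : IsUnit G := by
  have hinj : Function.Injective (LinearMap.mulRight ℝ G) := by
    rw [← LinearMap.ker_eq_bot, LinearMap.ker_eq_bot']
    exact h
  obtain ⟨M, hM⟩ := LinearMap.injective_iff_surjective.1 hinj 1
  have hM' : M * G = 1 := hM
  exact ⟨⟨G, M, mul_eq_one_comm.1 hM', hM'⟩, rfl⟩

/-- The matrix `[1 | A]` with its columns permuted by `σ`. -/
def rowMatrix (σ : Fin m ⊕ Fin (n - m) ≃ Fin n) (A : Fin m → Fin (n - m) → K) :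
    Matrix (Fin m) (Fin n) K := Matrix.of (rows σ A)

lemma mul_rowMatrix_inl (σ : Fin m ⊕ Fin (n - m) ≃ Fin n) (A : Fin m → Fin (n - m) → K)
    {l : Type*} (M : Matrix l (Fin m) K) (a : l) (k : Fin m) :
    (M * rowMatrix σ A) a (σ (Sum.inl k)) = M a k := by
  simp [Matrix.mul_apply, rowMatrix, Pi.single_apply]

lemma mul_rowMatrix_inr (σ : Fin m ⊕ Fin (n - m) ≃ Fin n) (A : Fin m → Fin (n - m) → K)
    {l : Type*} (M : Matrix l (Fin m) K) (a : l) (k : Fin (n - m)) :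
    (M * rowMatrix σ A) a (σ (Sum.inr k)) = (M * Matrix.of A) a k := by
  simp [Matrix.mul_apply, rowMatrix]

/-- The Gram matrix of the rows of `[1 | A]`. -/
def gram (σ : Fin m ⊕ Fin (n - m) ≃ Fin n) (A : Fin m → Fin (n - m) → K) :
    Matrix (Fin m) (Fin m) K := rowMatrix σ A * (rowMatrix σ A)ᴴ

/-- If `R` is the row matrix and `M R Rᴴ = 0`, then `M R` has zero norm, so `M R = 0`; its pivot
columns are `M`. -/
lemma isUnit_gram (σ : Fin m ⊕ Fin (n - m) ≃ Fin n) (A : Fin m → Fin (n - m) → K) :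
    IsUnit (gram σ A) := by
  refine isUnit_of_mul_eq_zero fun M hM => ?_
  have h1 : M * rowMatrix σ A = 0 := by
    apply eq_zero_of_retr_mul_conjTranspose
    rw [conjTranspose_mul, Matrix.mul_assoc, ← Matrix.mul_assoc (rowMatrix σ A),
      ← Matrix.mul_assoc M]
    change retr ((M * gram σ A) * _) = 0
    rw [hM, Matrix.zero_mul, map_zero]
  ext a k
  have h2 := mul_rowMatrix_inl σ A M a k
  rw [h1] at h2
  exact h2.symm

/-- The orthogonal projection onto the row space of `[1 | A]`. -/
def projMatrix (σ : Fin m ⊕ Fin (n - m) ≃ Fin n) (A : Fin m → Fin (n - m) → K) :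
    Matrix (Fin n) (Fin n) K :=
  (rowMatrix σ A)ᴴ * (Ring.inverse (gram σ A) * rowMatrix σ A)

lemma isOrthProj_projMatrix (σ : Fin m ⊕ Fin (n - m) ≃ Fin n) (A : Fin m → Fin (n - m) → K) :
    IsOrthProj (ofMatrix σ A).1 (projMatrix σ A) where
  conjTranspose_eq := by
    have h : (Ring.inverse (gram σ A))ᴴ = Ring.inverse (gram σ A) := by
      rw [← Matrix.star_eq_conjTranspose, ← Ring.inverse_star]
      simp [gram, Matrix.star_eq_conjTranspose]
    rw [projMatrix, conjTranspose_mul, conjTranspose_mul, h, conjTranspose_conjTranspose,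
      Matrix.mul_assoc]
  mem x := by
    rw [projMatrix, ← Matrix.mul_assoc, ← Matrix.vecMul_vecMul, Matrix.vecMul_eq_sum]
    exact Submodule.sum_mem _ fun i _ => Submodule.smul_mem _ _ (rows_mem_ofMatrix σ A i)
  fix x hx := by
    rw [ofMatrix, Submodule.mem_span_range_iff_exists_fun] at hx
    obtain ⟨c, rfl⟩ := hx
    have h1 : ∑ i, c i • rows σ A i = c ᵥ* rowMatrix σ A := by
      rw [Matrix.vecMul_eq_sum]; rfl
    rw [h1, Matrix.vecMul_vecMul, projMatrix, ← Matrix.mul_assoc, ← Matrix.mul_assoc]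
    change c ᵥ* (gram σ A * _ * _) = _
    rw [Ring.mul_inverse_cancel _ (isUnit_gram σ A), Matrix.one_mul]

lemma exists_isOrthProj (V : Gr K n m) : ∃ Q, IsOrthProj V.1 Q := by
  obtain ⟨σ, A, rfl⟩ := exists_ofMatrix_eq V
  exact ⟨_, isOrthProj_projMatrix σ A⟩

/-- The matrix of the orthogonal projection onto a subspace. -/
def proj (V : Gr K n m) : Matrix (Fin n) (Fin n) K := (exists_isOrthProj V).choose

lemma isOrthProj_proj (V : Gr K n m) : IsOrthProj V.1 (proj V) := (exists_isOrthProj V).choose_spec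

lemma proj_ofMatrix (σ : Fin m ⊕ Fin (n - m) ≃ Fin n) (A : Fin m → Fin (n - m) → K) :
    proj (ofMatrix σ A) = projMatrix σ A :=
  (isOrthProj_proj _).eq (isOrthProj_projMatrix σ A)

lemma conjTranspose_proj (V : Gr K n m) : (proj V)ᴴ = proj V := (isOrthProj_proj V).conjTranspose_eq

lemma proj_mul_self (V : Gr K n m) : proj V * proj V = proj V := (isOrthProj_proj V).mul_self

lemma proj_mul_proj_eq_iff {l : ℕ} (V : Gr K n m) (W : Gr K n l) :
    proj V * proj W = proj V ↔ V.1 ≤ W.1 :=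
  (isOrthProj_proj V).mul_eq_left_iff (isOrthProj_proj W)

lemma retr_proj (V : Gr K n m) : retr (proj V) = m := by
  obtain ⟨σ, A, rfl⟩ := exists_ofMatrix_eq V
  rw [proj_ofMatrix, projMatrix, retr_mul_comm, Matrix.mul_assoc]
  change retr (_ * gram σ A) = _
  rw [Ring.inverse_mul_cancel _ (isUnit_gram σ A), retr_one, Fintype.card_fin]

/-- The left side is the squared norm of `P_V - P_V P_W`, so this identity yields both the bound on
the real trace of `P_V P_W` and its equality case. -/
lemma retr_proj_sub_mul {l : ℕ} (V : Gr K n m) (W : Gr K n l) :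
    retr ((proj V - proj V * proj W) * (proj V - proj V * proj W)ᴴ) =
      m - retr (proj V * proj W) := by
  have h1 : (proj V - proj V * proj W) * (proj V - proj V * proj W)ᴴ =
      proj V - proj V * (proj W * proj V) := by
    rw [conjTranspose_sub, conjTranspose_mul, conjTranspose_proj, conjTranspose_proj, sub_mul,
      mul_sub, mul_sub, proj_mul_self, ← mul_assoc (proj V * proj W) (proj W),
      mul_assoc (proj V) (proj W) (proj W), proj_mul_self, mul_assoc]
    abel
  rw [h1, map_sub, retr_proj, retr_mul_comm, mul_assoc, proj_mul_self, retr_mul_comm]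

lemma retr_proj_mul_proj_le_left {l : ℕ} (V : Gr K n m) (W : Gr K n l) :
    retr (proj V * proj W) ≤ m := by
  have := retr_mul_conjTranspose_nonneg (proj V - proj V * proj W)
  rw [retr_proj_sub_mul] at this
  linarith

lemma retr_proj_mul_proj_le {l : ℕ} (V : Gr K n m) (W : Gr K n l) :
    retr (proj V * proj W) ≤ (min m l : ℕ) := by
  rcases min_choice m l with h | h <;> rw [h]
  · exact retr_proj_mul_proj_le_left V W
  · rw [retr_mul_comm]
    exact retr_proj_mul_proj_le_left W V

lemma retr_proj_mul_proj_eq_left_iff {l : ℕ} (V : Gr K n m) (W : Gr K n l) :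
    retr (proj V * proj W) = m ↔ V.1 ≤ W.1 := by
  rw [← proj_mul_proj_eq_iff]
  constructor
  · intro h
    have := retr_proj_sub_mul V W
    rw [h, sub_self] at this
    exact (sub_eq_zero.1 (eq_zero_of_retr_mul_conjTranspose this)).symm
  · intro h
    rw [h, retr_proj]

lemma retr_proj_mul_proj_eq_iff (V W : Gr K n m) : retr (proj V * proj W) = m ↔ V = W := by
  rw [retr_proj_mul_proj_eq_left_iff]
  constructor
  · intro h
    exact Subtype.ext (Submodule.eq_of_le_of_finrank_eq h (V.2.trans W.2.symm))
  · rintro rfl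
    exact le_rfl

lemma proj_injective : Function.Injective (proj : Gr K n m → Matrix (Fin n) (Fin n) K) := by
  intro V W h
  rw [← retr_proj_mul_proj_eq_iff, ← h, proj_mul_self, retr_proj]

end Gram

/-! ### The spectral theorem -/

section Spectral

variable {K : Type*} [NormedDivisionRing K] [NormedAlgebra ℝ K] [FiniteDimensional ℝ K]
  [StarRing K] [HermitianAlgebra K] {n : ℕ}

lemma vecMul_dotProduct_star {A : Matrix (Fin n) (Fin n) K} (hA : Aᴴ = A) (x y : Fin n → K) :
    (x ᵥ* A) ⬝ᵥ star y = x ⬝ᵥ star (y ᵥ* A) := by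
  rw [Matrix.star_vecMul, hA, Matrix.dotProduct_mulVec]

lemma dotProduct_star_self (x : Fin n → K) :
    x ⬝ᵥ star x = algebraMap ℝ K (∑ i, ‖x i‖ ^ 2) := by
  simp [dotProduct, mul_star_self]

/-- The real inner product on `Kⁿ`. -/
def realForm (K : Type*) [NormedDivisionRing K] [NormedAlgebra ℝ K]
    [StarRing K] [HermitianAlgebra K] (n : ℕ) :
    (Fin n → K) →ₗ[ℝ] (Fin n → K) →ₗ[ℝ] ℝ :=
  LinearMap.mk₂ ℝ (fun x y => re (x ⬝ᵥ star y))
    (fun x y z => by rw [add_dotProduct, map_add])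
    (fun c x y => by rw [smul_dotProduct, map_smul])
    (fun x y z => by rw [star_add, dotProduct_add, map_add])
    (fun c x y => by rw [star_smul, star_trivial, dotProduct_smul, map_smul])

lemma realForm_self (x : Fin n → K) : realForm K n x x = ∑ i, ‖x i‖ ^ 2 := by
  change re (x ⬝ᵥ star x) = _
  rw [dotProduct_star_self, re_algebraMap]

lemma realForm_comm (x y : Fin n → K) : realForm K n x y = realForm K n y x := by
  change re (x ⬝ᵥ star y) = re (y ⬝ᵥ star x)
  rw [← re_star, ← Matrix.dotProduct_star]

lemma realForm_definite (x : Fin n → K) (h : realForm K n x x = 0) : x = 0 := by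
  rw [realForm_self, Finset.sum_eq_zero_iff_of_nonneg fun _ _ => by positivity] at h
  ext i
  simpa using h i (Finset.mem_univ _)

/-- Induction on `k`: the orthogonal complement of the eigenvectors already found is nonzero by
dimension and invariant because `A` is Hermitian with real eigenvalues. A real-symmetric operator on
it has an eigenvector, which is then normalized. -/
lemma exists_orthonormal_eigenvectors {A : Matrix (Fin n) (Fin n) K} (hA : Aᴴ = A) (k : ℕ)
    (hk : k ≤ n) : ∃ (u : Fin k → Fin n → K) (μ : Fin k → ℝ),
      (∀ i j, u i ⬝ᵥ star (u j) = if i = j then 1 else 0) ∧ ∀ i, u i ᵥ* A = μ i • u i := by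
  induction k with
  | zero => exact ⟨fun i => i.elim0, fun i => i.elim0, fun i => i.elim0, fun i => i.elim0⟩
  | succ k ih =>
    obtain ⟨u, μ, hu, hμ⟩ := ih (by omega)
    let Φ : (Fin n → K) →ₗ[K] (Fin k → K) :=
      { toFun := fun x i => x ⬝ᵥ star (u i)
        map_add' := fun x y => by ext i; simp [add_dotProduct]
        map_smul' := fun c x => by ext i; simp [smul_dotProduct] }
    have hne : LinearMap.ker Φ ≠ ⊥ := LinearMap.ker_ne_bot_of_finrank_lt (by simpa using hk)
    let W : Submodule ℝ (Fin n → K) := (LinearMap.ker Φ).restrictScalars ℝ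
    have hW : ∀ x, x ∈ W ↔ ∀ i, x ⬝ᵥ star (u i) = 0 := fun x => by
      simp only [W, Submodule.restrictScalars_mem, LinearMap.mem_ker]
      exact funext_iff
    have : Nontrivial W := by
      obtain ⟨x, hx, hx0⟩ := Submodule.exists_mem_ne_zero_of_ne_bot hne
      exact ⟨⟨⟨x, hx⟩, 0, fun h => hx0 (congrArg Subtype.val h)⟩⟩
    have hinv : ∀ x ∈ W, (Matrix.vecMulLinear A).restrictScalars ℝ x ∈ W := by
      intro x hx
      rw [hW] at hx ⊢
      intro i
      change (x ᵥ* A) ⬝ᵥ _ = _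
      rw [vecMul_dotProduct_star hA, hμ, star_smul, star_trivial, dotProduct_smul, hx, smul_zero]
    obtain ⟨ν, ⟨w, hwW⟩, hw0, hw⟩ := exists_eigenvector_of_form
      ((realForm K n).domRestrict₁₂ W W) (fun x y => realForm_comm _ _)
      (fun x => (realForm_self (x : Fin n → K)).symm ▸ by positivity)
      (fun x hx => Subtype.ext (realForm_definite _ hx))
      (((Matrix.vecMulLinear A).restrictScalars ℝ).restrict hinv)
      (fun x y => congrArg re (vecMul_dotProduct_star hA _ _))
    have hw' : w ᵥ* A = ν • w := congrArg Subtype.val hw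
    have hpos : 0 < ∑ i, ‖w i‖ ^ 2 := by
      rw [← realForm_self]
      refine lt_of_le_of_ne (by rw [realForm_self]; positivity) fun h => hw0 ?_
      exact Subtype.ext (realForm_definite w h.symm)
    let r : ℝ := (Real.sqrt (∑ i, ‖w i‖ ^ 2))⁻¹
    have hr : r * r * ∑ i, ‖w i‖ ^ 2 = 1 := by
      have := Real.mul_self_sqrt hpos.le
      have h2 := Real.sqrt_pos.2 hpos
      simp only [r]
      rw [← this, Real.sqrt_mul_self h2.le]
      field_simp
    have h1 : (r • w) ⬝ᵥ star (r • w) = 1 := by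
      rw [star_smul, star_trivial, dotProduct_smul, smul_dotProduct, dotProduct_star_self,
        smul_smul, Algebra.smul_def, ← map_mul, hr, map_one]
    have h2 : ∀ i, (r • w) ⬝ᵥ star (u i) = 0 := fun i => by
      rw [smul_dotProduct, (hW w).1 hwW, smul_zero]
    have h3 : ∀ i, u i ⬝ᵥ star (r • w) = 0 := fun i => by
      have := congrArg star (h2 i)
      rwa [star_zero, ← Matrix.dotProduct_star] at this
    refine ⟨Fin.snoc u (r • w), Fin.snoc μ ν, fun i j => ?_, fun i => ?_⟩
    · refine Fin.lastCases ?_ (fun i => ?_) i <;> refine Fin.lastCases ?_ (fun j => ?_) j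
      · simpa using h1
      · simpa [(Fin.castSucc_ne_last j).symm] using h2 j
      · simpa [Fin.castSucc_ne_last i] using h3 i
      · simp [hu]
    · refine Fin.lastCases ?_ (fun i => ?_) i
      · simp only [Fin.snoc_last]
        rw [Matrix.smul_vecMul, hw', smul_comm]
      · simp only [Fin.snoc_castSucc]
        exact hμ i

end Spectral

/-! ### Weighted sums of the projections of a flag -/

section Weighted

variable {K : Type*} [NormedDivisionRing K] [NormedAlgebra ℝ K] [FiniteDimensional ℝ K]
  [StarRing K] [HermitianAlgebra K] {n : ℕ}

lemma retr_proj_mul_proj_of_flag (F : CompleteFlag K n) (i j : Fin (n - 1)) :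
    retr (proj (F.space i) * proj (F.space j)) = (min (i + 1) (j + 1) : ℕ) := by
  rcases le_total i j with h | h
  · rw [(retr_proj_mul_proj_eq_left_iff _ _).2 (F.mono i j h), min_eq_left (by simpa using h)]
  · rw [retr_mul_comm, (retr_proj_mul_proj_eq_left_iff _ _).2 (F.mono j i h),
      min_eq_right (by simpa using h)]

/-- As a function of `k`, `min (i + 1) k` is concave with its only kink at `k = i + 1`. A second
difference therefore isolates one weight and kills the linear term `c * k`. -/
lemma eq_of_sum_mul_min_eq {t t' : Fin (n - 1) → ℝ} {c : ℝ}
    (h : ∀ k ≤ n, ∑ i, t i * (min (i + 1) k : ℕ) = ∑ i, t' i * (min (i + 1) k : ℕ) + c * k) :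
    t = t' := by
  have key : ∀ (s : Fin (n - 1) → ℝ) (j : Fin (n - 1)),
      2 * ∑ i, s i * (min (i + 1) (j + 1) : ℕ) - ∑ i, s i * (min (i + 1) (j : ℕ) : ℕ) -
        ∑ i, s i * (min (i + 1) (j + 2) : ℕ) = s j := by
    intro s j
    rw [Finset.mul_sum, ← Finset.sum_sub_distrib, ← Finset.sum_sub_distrib,
      Finset.sum_eq_single j]
    · rw [min_self, min_eq_right (by omega), min_eq_left (by omega)]
      push_cast
      ring
    · intro i _ hij
      have hij' : (i : ℕ) ≠ j := fun h => hij (Fin.ext h)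
      rcases lt_or_gt_of_ne hij' with h | h
      · rw [min_eq_left (by omega), min_eq_left (by omega), min_eq_left (by omega)]
        ring
      · rw [min_eq_right (by omega), min_eq_right (by omega), min_eq_right (by omega)]
        push_cast
        ring
    · simp
  funext j
  have h0 := h j (by omega)
  have h1 := h (j + 1) (by omega)
  have h2 := h (j + 2) (by omega)
  rw [← key t j, ← key t' j, h0, h1, h2]
  push_cast
  ring

/-- The weights and the subspaces with positive weight are determined by the weighted sum of the
projections of a flag, up to a scalar matrix. -/
lemma eq_of_sum_smul_proj_eq {F F' : CompleteFlag K n} {t t' : Fin (n - 1) → ℝ}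
    (ht : ∀ i, 0 ≤ t i) (ht' : ∀ i, 0 ≤ t' i) {c : ℝ}
    (h : ∑ i, t i • proj (F.space i) = ∑ i, t' i • proj (F'.space i) + c • 1) :
    t = t' ∧ ∀ i, t i ≠ 0 → F.space i = F'.space i := by
  have hmul : ∀ (G : CompleteFlag K n) (s : Fin (n - 1) → ℝ) (Q : Matrix (Fin n) (Fin n) K),
      retr ((∑ i, s i • proj (G.space i)) * Q) = ∑ i, s i * retr (proj (G.space i) * Q) := by
    intro G s Q
    simp [Finset.sum_mul]
  have hle : ∀ (G : CompleteFlag K n) (s : Fin (n - 1) → ℝ), (∀ i, 0 ≤ s i) →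
      ∀ {k : ℕ} (W : Gr K n k), retr ((∑ i, s i • proj (G.space i)) * proj W) ≤
        ∑ i, s i * (min (i + 1) k : ℕ) := by
    intro G s hs k W
    rw [hmul]
    exact Finset.sum_le_sum fun i _ =>
      mul_le_mul_of_nonneg_left (retr_proj_mul_proj_le _ _) (hs i)
  have heq : ∀ (G : CompleteFlag K n) (s : Fin (n - 1) → ℝ) (j : Fin (n - 1)),
      retr ((∑ i, s i • proj (G.space i)) * proj (G.space j)) =
        ∑ i, s i * (min (i + 1) (j + 1) : ℕ) := by
    intro G s j
    rw [hmul]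
    exact Finset.sum_congr rfl fun i _ => by rw [retr_proj_mul_proj_of_flag]
  have hc : ∀ {k : ℕ} (W : Gr K n k), retr ((∑ i, t i • proj (F.space i)) * proj W) =
      retr ((∑ i, t' i • proj (F'.space i)) * proj W) + c * k := by
    intro k W
    rw [h, add_mul, map_add, smul_mul_assoc, one_mul, map_smul, retr_proj, smul_eq_mul]
  -- Pairing with a member of one flag is exact for that flag and bounded above for the other; using
  -- both flags gives the two inequalities.
  have hk : ∀ j : Fin (n - 1), ∑ i, t i * (min (i + 1) (j + 1) : ℕ) =
      ∑ i, t' i * (min (i + 1) (j + 1) : ℕ) + c * (j + 1 : ℕ) := by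
    intro j
    apply le_antisymm
    · rw [← heq F, hc]
      gcongr
      exact hle F' t' ht' _
    · rw [← heq F', ← hc]
      exact hle F t ht _
  have htt : t = t' := by
    refine eq_of_sum_mul_min_eq (c := c) fun k hkn => ?_
    -- The interior values of `k` come from `hk`; the extreme value `k = n` comes from the trace.
    rcases Nat.eq_zero_or_pos k with rfl | hpos
    · simp
    · rcases hkn.eq_or_lt with rfl | hlt
      · have h1 := congrArg retr h
        simp only [map_add, map_sum, map_smul, retr_proj, retr_one, smul_eq_mul,
          Fintype.card_fin] at h1
        have h2 : ∀ i : Fin (k - 1), min ((i : ℕ) + 1) k = i + 1 := fun i => by omega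
        simpa only [h2] using h1
      · have := hk ⟨k - 1, by omega⟩
        have h3 : k - 1 + 1 = k := by omega
        simpa only [h3] using this
  refine ⟨htt, fun j hj => ?_⟩
  -- A vanishing sum of nonnegative terms: the term `i = j` is the equality case of the trace
  -- inequality, which forces the two subspaces to coincide.
  have h1 : ∑ i, t i * ((min (i + 1) (j + 1) : ℕ) -
      retr (proj (F.space i) * proj (F'.space j))) = 0 := by
    simp only [mul_sub, Finset.sum_sub_distrib]
    rw [hk, ← hmul, hc, heq]
    ring
  rw [Finset.sum_eq_zero_iff_of_nonneg fun i _ =>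
    mul_nonneg (ht i) (sub_nonneg.2 (retr_proj_mul_proj_le _ _))] at h1
  have h2 := (mul_eq_zero.1 (h1 j (Finset.mem_univ _))).resolve_left hj
  rw [min_self, sub_eq_zero] at h2
  exact (retr_proj_mul_proj_eq_iff _ _).1 h2.symm

lemma sum_range_ite_sub (l : ℕ → ℝ) {a N : ℕ} (h : a ≤ N) :
    ∑ i ∈ Finset.range N, (if a ≤ i then l i - l (i + 1) else 0) = l a - l N := by
  induction N, h using Nat.le_induction with
  | base =>
    rw [sub_self]
    exact Finset.sum_eq_zero fun i hi => if_neg (by simpa using hi)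
  | succ N hN ih =>
    rw [Finset.sum_range_succ, ih, if_pos hN]
    ring

/-- A Hermitian matrix is, up to a scalar matrix, a nonnegative combination of the projections of
a complete flag. -/
lemma exists_flag_sum_smul_proj (hn : 1 ≤ n) {A : Matrix (Fin n) (Fin n) K} (hA : Aᴴ = A) :
    ∃ (F : CompleteFlag K n) (t : Fin (n - 1) → ℝ) (c : ℝ), (∀ i, 0 ≤ t i) ∧
      A = ∑ i, t i • proj (F.space i) + c • 1 := by
  obtain ⟨u, μ, hu, hμ⟩ := exists_orthonormal_eigenvectors hA n le_rfl
  -- Sorting the negatives lists the eigenvalues in decreasing order, which makes the gaps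
  -- nonnegative.
  let σ := Tuple.sort fun i => -μ i
  let U : Matrix (Fin n) (Fin n) K := Matrix.of fun i => u (σ i)
  let l : ℕ → ℝ := fun k => if h : k < n then μ (σ ⟨k, h⟩) else 0
  have hl : ∀ k, k + 1 < n → l (k + 1) ≤ l k := by
    intro k hk
    have := Tuple.monotone_sort (fun i => -μ i)
      (show (⟨k, by omega⟩ : Fin n) ≤ ⟨k + 1, hk⟩ from Nat.le_succ k)
    simp only [l, hk, show k < n by omega, dif_pos]
    simpa using this
  have hU : U * Uᴴ = 1 := by
    ext i j
    rw [Matrix.one_apply]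
    have := hu (σ i) (σ j)
    simp only [σ.injective.eq_iff] at this
    rw [← this]
    rfl
  have hU' : Uᴴ * U = 1 := mul_eq_one_comm.1 hU
  -- The functional calculus in the eigenbasis: `A`, the identity and the projections of the flag
  -- are all values of this one linear map, so the claim becomes an identity between functions on
  -- `Fin n`.
  let D : (Fin n → ℝ) →ₗ[ℝ] Matrix (Fin n) (Fin n) K :=
    { toFun := fun f => Uᴴ * (Matrix.diagonal fun a => algebraMap ℝ K (f a)) * U
      map_add' := fun f g => by
        rw [← add_mul, ← mul_add, Matrix.diagonal_add]
        simp
      map_smul' := fun r f => by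
        rw [RingHom.id_apply, ← smul_mul_assoc, ← mul_smul_comm, ← Matrix.diagonal_smul]
        congr 3
        funext a
        simp [Algebra.smul_def] }
  have hD : ∀ f, D f = Uᴴ * (Matrix.diagonal fun a => algebraMap ℝ K (f a)) * U := fun f => rfl
  have hD1 : D 1 = 1 := by
    rw [hD]
    simp [hU']
  have hDA : D (fun a => l a) = A := by
    have h1 : (Matrix.diagonal fun a : Fin n => algebraMap ℝ K (l a)) * U = U * A := by
      ext i j
      rw [Matrix.diagonal_mul]
      have := congrFun (hμ (σ i)) j
      simp only [l, i.2, dif_pos, ← Algebra.smul_def]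
      exact this.symm
    rw [hD, mul_assoc, h1, ← mul_assoc, hU', one_mul]
  have hli : LinearIndependent K fun i => u (σ i) := by
    rw [Fintype.linearIndependent_iff]
    intro g hg
    have h1 : g ᵥ* U = 0 := by
      rw [Matrix.vecMul_eq_sum]
      exact hg
    have h2 : g ᵥ* (U * Uᴴ) = 0 := by
      rw [← Matrix.vecMul_vecMul, h1, Matrix.zero_vecMul]
    rw [hU, Matrix.vecMul_one] at h2
    exact fun i => congrFun h2 i
  let S : Fin (n - 1) → Submodule K (Fin n → K) := fun i =>
    Submodule.span K ((fun a => u (σ a)) '' {a | (a : ℕ) ≤ i})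
  have hS : ∀ i, finrank K (S i) = i + 1 := by
    intro i
    have hi : (i : ℕ) + 1 ≤ n := by omega
    have h2 : (fun a => u (σ a)) '' {a | (a : ℕ) ≤ i} =
        range ((fun a => u (σ a)) ∘ Fin.castLE hi) := by
      rw [range_comp]
      congr 1
      ext k
      constructor
      · intro hk
        exact ⟨⟨k, Nat.lt_succ_of_le hk⟩, by ext; simp⟩
      · rintro ⟨k, rfl⟩
        exact Nat.le_of_lt_succ k.2
    change finrank K (Submodule.span K ((fun a => u (σ a)) '' {a | (a : ℕ) ≤ i})) = _
    rw [h2, finrank_span_eq_card (hli.comp _ (Fin.castLE_injective hi)), Fintype.card_fin]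
  let ind : Fin (n - 1) → Fin n → ℝ := fun i a => if (a : ℕ) ≤ i then 1 else 0
  have hproj : ∀ i, IsOrthProj (S i) (D (ind i)) := by
    intro i
    refine ⟨?_, fun x => ?_, fun x hx => ?_⟩
    · rw [hD, conjTranspose_mul, conjTranspose_mul, conjTranspose_conjTranspose,
        Matrix.diagonal_conjTranspose, mul_assoc]
      congr 3
      ext a
      exact star_algebraMap _
    · rw [hD, ← Matrix.vecMul_vecMul, Matrix.vecMul_eq_sum]
      refine Submodule.sum_mem _ fun a _ => ?_
      rw [← Matrix.vecMul_vecMul, Matrix.vecMul_diagonal]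
      by_cases ha : (a : ℕ) ≤ i
      · exact Submodule.smul_mem _ _ (Submodule.subset_span ⟨a, ha, rfl⟩)
      · simp [ind, ha]
    · refine Submodule.span_induction ?_ ?_ ?_ ?_ hx
      · rintro _ ⟨a, ha, rfl⟩
        have h1 : U * D (ind i) = (Matrix.diagonal fun a => algebraMap ℝ K (ind i a)) * U := by
          rw [hD, mul_assoc, ← mul_assoc U, hU, one_mul]
        have h2 := congrFun h1 a
        change u (σ a) ᵥ* D (ind i) = _ at h2
        rw [h2]
        ext j
        rw [Matrix.diagonal_mul]
        have ha' : (a : ℕ) ≤ i := ha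
        simp only [ind, if_pos ha', map_one, one_mul]
        rfl
      · exact Matrix.zero_vecMul _
      · intro x y _ _ hx hy
        rw [Matrix.add_vecMul, hx, hy]
      · intro r x _ hx
        rw [Matrix.smul_vecMul, hx]
  let F : CompleteFlag K n :=
    { space := fun i => ⟨S i, hS i⟩
      mono := fun i j hij => Submodule.span_mono (image_mono fun a (ha : (a : ℕ) ≤ i) =>
        ha.trans hij) }
  refine ⟨F, fun i => l i - l (i + 1), l (n - 1), fun i => sub_nonneg.2 (hl i (by omega)), ?_⟩
  have hF : ∀ i, proj (F.space i) = D (ind i) := fun i => (isOrthProj_proj (F.space i)).eq (hproj i)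
  simp only [hF]
  conv_rhs => rw [← hD1]
  simp only [← map_smul, ← map_sum, ← map_add]
  rw [← hDA]
  congr 1
  funext a
  -- The `a`-th eigenvalue is the sum of the gaps from `a` on plus the last eigenvalue, which is the
  -- scalar `c`.
  have h1 := sum_range_ite_sub l (show (a : ℕ) ≤ n - 1 by omega)
  rw [← Fin.sum_univ_eq_sum_range (fun i => if (a : ℕ) ≤ i then l i - l (i + 1) else 0)] at h1
  simp only [Pi.add_apply, Finset.sum_apply, Pi.smul_apply, smul_eq_mul, ind, mul_ite, mul_one,
    mul_zero, Pi.one_apply, h1]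
  ring

end Weighted

/-! ### Smooth embeddings -/

section SmoothEmbedding

variable {E E' E'' : Type*} [NormedAddCommGroup E] [NormedSpace ℝ E]
  [NormedAddCommGroup E'] [NormedSpace ℝ E'] [NormedAddCommGroup E''] [NormedSpace ℝ E'']
  {M M' M'' : Type*} [TopologicalSpace M] [ChartedSpace E M]
  [TopologicalSpace M'] [ChartedSpace E' M'] [TopologicalSpace M''] [ChartedSpace E'' M'']

lemma injective_mfderiv_of_comp {f : M → M'} {g : M' → M''} {x : M}
    (hg : MDifferentiableAt 𝓘(ℝ, E') 𝓘(ℝ, E'') g (f x))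
    (hf : MDifferentiableAt 𝓘(ℝ, E) 𝓘(ℝ, E') f x)
    (h : Function.Injective (mfderiv 𝓘(ℝ, E) 𝓘(ℝ, E'') (g ∘ f) x)) :
    Function.Injective (mfderiv 𝓘(ℝ, E) 𝓘(ℝ, E') f x) := by
  rw [mfderiv_comp x hg hf] at h
  exact Function.Injective.of_comp (f := mfderiv 𝓘(ℝ, E') 𝓘(ℝ, E'') g (f x)) h

/-- Both the derivative's injectivity and the inducing property are inherited from a composite by
its first factor. A smooth map that recovers a known embedding thus suffices. -/
lemma IsSmoothEmbedding.of_comp {f : M → M'} {g : M' → M''}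
    (hf : ContMDiff 𝓘(ℝ, E) 𝓘(ℝ, E') ∞ f) (hg : ContMDiff 𝓘(ℝ, E') 𝓘(ℝ, E'') ∞ g)
    (h : IsSmoothEmbedding E E'' (g ∘ f)) : IsSmoothEmbedding E E' f :=
  ⟨hf, fun x => injective_mfderiv_of_comp (hg.mdifferentiableAt (by simp))
    (hf.mdifferentiableAt (by simp)) (h.2.1 x),
    IsEmbedding.of_comp hf.continuous hg.continuous h.2.2⟩

end SmoothEmbedding

/-! ### The Grassmannian as a space of projections -/

section GrSmooth

variable {K : Type*} [NormedDivisionRing K] [NormedAlgebra ℝ K] [FiniteDimensional ℝ K]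
  [StarRing K] [HermitianAlgebra K] {n m : ℕ}

attribute [local instance] Matrix.linftyOpNormedRing Matrix.linftyOpNormedAlgebra

lemma contDiff_matrix {E : Type*} [NormedAddCommGroup E] [NormedSpace ℝ E] {p : ℕ}
    {f : E → Matrix (Fin p) (Fin p) K} (h : ∀ i j, ContDiff ℝ ∞ fun x => f x i j) :
    ContDiff ℝ ∞ f := by
  let L : (Fin p → Fin p → K) →ₗ[ℝ] Matrix (Fin p) (Fin p) K :=
    { toFun := Matrix.of, map_add' := fun _ _ => rfl, map_smul' := fun _ _ => rfl }
  have hL : ContDiff ℝ ∞ L := L.toContinuousLinearMap.contDiff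
  exact hL.comp (contDiff_pi.2 fun i => contDiff_pi.2 fun j => h i j)

lemma contDiff_entry {p : ℕ} (i j : Fin p) :
    ContDiff ℝ ∞ fun A : Matrix (Fin p) (Fin p) K => A i j := by
  let L : Matrix (Fin p) (Fin p) K →ₗ[ℝ] K :=
    { toFun := fun A => A i j, map_add' := fun _ _ => rfl, map_smul' := fun _ _ => rfl }
  exact L.toContinuousLinearMap.contDiff

lemma contDiff_star : ContDiff ℝ ∞ (star : K → K) := by
  let L : K →ₗ[ℝ] K :=
    { toFun := star, map_add' := star_add, map_smul' := fun r a => by simp }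
  exact L.toContinuousLinearMap.contDiff

lemma contDiffAt_ring_inverse {p : ℕ} {A : Matrix (Fin p) (Fin p) K} (h : IsUnit A) :
    ContDiffAt ℝ ∞ Ring.inverse A := by
  have : CompleteSpace (Matrix (Fin p) (Fin p) K) := FiniteDimensional.complete ℝ _
  obtain ⟨u, rfl⟩ := h
  exact contDiffAt_ringInverse ℝ u

lemma contDiff_gram (σ : Fin m ⊕ Fin (n - m) ≃ Fin n) : ContDiff ℝ ∞ (gram (K := K) σ) := by
  refine contDiff_matrix fun i k => ?_
  simp only [gram, Matrix.mul_apply, Matrix.conjTranspose_apply]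
  exact ContDiff.sum fun j _ => (contDiff_rows σ i j).mul (contDiff_star.comp (contDiff_rows σ k j))

lemma contDiff_projMatrix (σ : Fin m ⊕ Fin (n - m) ≃ Fin n) :
    ContDiff ℝ ∞ fun (A : Fin m → Fin (n - m) → K) (a b : Fin n) => projMatrix σ A a b := by
  have hinv : ContDiff ℝ ∞ fun A => Ring.inverse (gram (K := K) σ A) :=
    contDiff_iff_contDiffAt.2 fun A =>
      (contDiffAt_ring_inverse (isUnit_gram σ A)).comp A (contDiff_gram σ).contDiffAt
  refine contDiff_pi.2 fun a => contDiff_pi.2 fun b => ?_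
  simp only [projMatrix, Matrix.mul_apply, Matrix.conjTranspose_apply]
  exact ContDiff.sum fun i _ => (contDiff_star.comp (contDiff_rows σ i a)).mul
    (ContDiff.sum fun k _ => ((contDiff_entry i k).comp hinv).mul (contDiff_rows σ k b))

/-- The block of a matrix on the pivot rows and columns. -/
def cornerBlock (σ : Fin m ⊕ Fin (n - m) ≃ Fin n) (Q : Fin n → Fin n → K) :
    Matrix (Fin m) (Fin m) K :=
  Matrix.of fun i k => Q (σ (Sum.inl i)) (σ (Sum.inl k))

/-- The affine coordinates of a subspace in terms of its orthogonal projection. -/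
def projCoord (σ : Fin m ⊕ Fin (n - m) ≃ Fin n) (Q : Fin n → Fin n → K) :
    Fin m → Fin (n - m) → K :=
  fun i j => ∑ k, Ring.inverse (cornerBlock σ Q) i k * Q (σ (Sum.inl k)) (σ (Sum.inr j))

lemma contDiff_cornerBlock (σ : Fin m ⊕ Fin (n - m) ≃ Fin n) :
    ContDiff ℝ ∞ (cornerBlock (K := K) σ) :=
  contDiff_matrix fun i k => contDiff_apply_apply ℝ K (σ (Sum.inl i)) (σ (Sum.inl k))

lemma contDiffAt_projCoord {σ : Fin m ⊕ Fin (n - m) ≃ Fin n} {Q : Fin n → Fin n → K}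
    (h : IsUnit (cornerBlock σ Q)) : ContDiffAt ℝ ∞ (projCoord σ) Q := by
  have hinv : ContDiffAt ℝ ∞ (fun Q : Fin n → Fin n → K => Ring.inverse (cornerBlock σ Q)) Q :=
    (contDiffAt_ring_inverse h).comp Q (contDiff_cornerBlock σ).contDiffAt
  refine contDiffAt_pi.2 fun i => contDiffAt_pi.2 fun j => ContDiffAt.sum fun k _ => ?_
  exact ((contDiff_entry (K := K) i k).contDiffAt.comp Q hinv).mul
    (contDiff_apply_apply ℝ K (σ (Sum.inl k)) (σ (Sum.inr j))).contDiffAt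

lemma isOpen_isUnit_cornerBlock (σ : Fin m ⊕ Fin (n - m) ≃ Fin n) :
    IsOpen {Q : Fin n → Fin n → K | IsUnit (cornerBlock σ Q)} := by
  have : CompleteSpace (Matrix (Fin m) (Fin m) K) := FiniteDimensional.complete ℝ _
  exact (Units.isOpen (R := Matrix (Fin m) (Fin m) K)).preimage
    (contDiff_cornerBlock (K := K) σ).continuous

lemma projMatrix_inl (σ : Fin m ⊕ Fin (n - m) ≃ Fin n) (A : Fin m → Fin (n - m) → K)
    (k : Fin m) (b : Fin n) :
    projMatrix σ A (σ (Sum.inl k)) b = (Ring.inverse (gram σ A) * rowMatrix σ A) k b := by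
  rw [projMatrix, Matrix.mul_apply, Finset.sum_eq_single k]
  · simp [rowMatrix]
  · intro i _ hi
    simp [rowMatrix, hi.symm]
  · simp

/-- The projection is `Rᴴ G⁻¹ R` and the pivot columns of `R` form the identity. So the affine
coordinates can be read off smoothly from the pivot rows of the projection. -/
lemma cornerBlock_projMatrix (σ : Fin m ⊕ Fin (n - m) ≃ Fin n) (A : Fin m → Fin (n - m) → K) :
    cornerBlock σ (projMatrix σ A) = Ring.inverse (gram σ A) := by
  ext i k
  simp only [cornerBlock, Matrix.of_apply]
  rw [projMatrix_inl, mul_rowMatrix_inl]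

lemma isUnit_cornerBlock_projMatrix (σ : Fin m ⊕ Fin (n - m) ≃ Fin n)
    (A : Fin m → Fin (n - m) → K) : IsUnit (cornerBlock σ (projMatrix σ A)) := by
  rw [cornerBlock_projMatrix]
  exact (isUnit_gram σ A).ringInverse

lemma projCoord_projMatrix (σ : Fin m ⊕ Fin (n - m) ≃ Fin n) (A : Fin m → Fin (n - m) → K) :
    projCoord σ (projMatrix σ A) = A := by
  have hu := (isUnit_gram σ A).ringInverse
  funext i j
  simp only [projCoord, projMatrix_inl, mul_rowMatrix_inr, cornerBlock_projMatrix]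
  have h : Ring.inverse (Ring.inverse (gram σ A)) * (Ring.inverse (gram σ A) *
      (Matrix.of A : Matrix (Fin m) (Fin (n - m)) K)) = Matrix.of A := by
    rw [← Matrix.mul_assoc, Ring.inverse_mul_cancel _ hu, Matrix.one_mul]
  exact congrFun (congrFun h i) j

/-- The entries of the orthogonal projection onto a subspace. -/
def projFun (V : Gr K n m) : Fin n → Fin n → K := fun a b => proj V a b

lemma projFun_injective : Function.Injective (projFun : Gr K n m → Fin n → Fin n → K) :=
  proj_injective

/-- The pivot rows of the projection lie in `V`, and the inverse corner block normalizes them to the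
form `[1 | A]`. The hypothesis is an open condition on the projection alone, which is what
continuity of the inverse of `projFun` requires. -/
lemma ofMatrix_projCoord {σ : Fin m ⊕ Fin (n - m) ≃ Fin n} {V : Gr K n m}
    (h : IsUnit (cornerBlock σ (projFun V))) : ofMatrix σ (projCoord σ (projFun V)) = V := by
  rw [ofMatrix_eq_iff]
  intro i
  have h1 : rows σ (projCoord σ (projFun V)) i =
      ∑ k, Ring.inverse (cornerBlock σ (projFun V)) i k • (Pi.single (σ (Sum.inl k)) 1 ᵥ* proj V) := by
    funext b
    obtain ⟨b, rfl⟩ := σ.surjective b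
    rcases b with b | b
    · have h2 : (Ring.inverse (cornerBlock σ (projFun V)) * cornerBlock σ (projFun V)) i b =
          (1 : Matrix (Fin m) (Fin m) K) i b := by
        rw [Ring.inverse_mul_cancel _ h]
      rw [Matrix.mul_apply, Matrix.one_apply] at h2
      simpa [Finset.sum_apply, Matrix.row_apply, cornerBlock, projFun, Pi.single_apply,
        eq_comm] using h2.symm
    · simp [Finset.sum_apply, projCoord, projFun, Matrix.row_apply]
  rw [h1]
  exact Submodule.sum_mem _ fun k _ => Submodule.smul_mem _ _ ((isOrthProj_proj V).mem _)

/-- The pivot columns of the preferred chart at a point. -/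
def pivots (V : Gr K n m) : Fin m ⊕ Fin (n - m) ≃ Fin n := (exists_ofMatrix_eq V).choose

lemma chartAt_symm_apply (V : Gr K n m) (A : Fin m → Fin (n - m) → K) :
    (chartAt (Fin m → Fin (n - m) → K) V).symm A = ofMatrix (pivots V) A := rfl

lemma projFun_eq_projMatrix_chartAt {V W : Gr K n m}
    (hW : W ∈ (chartAt (Fin m → Fin (n - m) → K) V).source) :
    projFun W = projMatrix (pivots V) (chartAt (Fin m → Fin (n - m) → K) V W) := by
  rw [← proj_ofMatrix, ← chartAt_symm_apply, OpenPartialHomeomorph.left_inv _ hW]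
  rfl

lemma contMDiff_projFun : ContMDiff 𝓘(ℝ, Fin m → Fin (n - m) → K)
    𝓘(ℝ, Fin n → Fin n → K) ∞ (projFun : Gr K n m → Fin n → Fin n → K) := by
  intro V
  have h1 : ContMDiffAt 𝓘(ℝ, Fin m → Fin (n - m) → K) 𝓘(ℝ, Fin m → Fin (n - m) → K) ∞
      (chartAt (Fin m → Fin (n - m) → K) V) V :=
    contMDiffOn_chart.contMDiffAt (chart_source_mem_nhds _ V)
  have h2 := (contDiff_projMatrix (K := K) (pivots V)).contMDiff.contMDiffAt.comp V h1
  refine h2.congr_of_eventuallyEq ?_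
  filter_upwards [chart_source_mem_nhds (Fin m → Fin (n - m) → K) V] with W hW
  exact projFun_eq_projMatrix_chartAt hW

lemma isUnit_cornerBlock_projFun {V W : Gr K n m}
    (hW : W ∈ (chartAt (Fin m → Fin (n - m) → K) V).source) :
    IsUnit (cornerBlock (pivots V) (projFun W)) := by
  rw [projFun_eq_projMatrix_chartAt hW]
  exact isUnit_cornerBlock_projMatrix _ _

lemma injective_mfderiv_projFun (V : Gr K n m) : Function.Injective
    (mfderiv 𝓘(ℝ, Fin m → Fin (n - m) → K) 𝓘(ℝ, Fin n → Fin n → K)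
      (projFun : Gr K n m → Fin n → Fin n → K) V) := by
  have hV := mem_chart_source (Fin m → Fin (n - m) → K) V
  refine injective_mfderiv_of_comp (E'' := Fin m → Fin (n - m) → K) (g := projCoord (pivots V))
    ?_ (contMDiff_projFun.mdifferentiableAt (by simp)) ?_
  · exact ((contDiffAt_projCoord (isUnit_cornerBlock_projFun hV)).contMDiffAt).mdifferentiableAt
      (by simp)
  · have h1 : projCoord (pivots V) ∘ projFun =ᶠ[𝓝 V]
        extChartAt 𝓘(ℝ, Fin m → Fin (n - m) → K) V := by
      filter_upwards [chart_source_mem_nhds (Fin m → Fin (n - m) → K) V] with W hW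
      simp only [Function.comp_apply]
      rw [projFun_eq_projMatrix_chartAt hW, projCoord_projMatrix]
      simp
    rw [h1.mfderiv_eq]
    exact (isInvertible_mfderiv_extChartAt (mem_extChartAt_source V)).injective

lemma isEmbedding_projFun :
    IsEmbedding (projFun : Gr K n m → Fin n → Fin n → K) := by
  refine ⟨isInducing_iff_nhds.2 fun V => le_antisymm
    (contMDiff_projFun.continuous.tendsto V).le_comap ?_, projFun_injective⟩
  have hV := mem_chart_source (Fin m → Fin (n - m) → K) V
  have hu := isUnit_cornerBlock_projFun hV
  -- On the neighbourhoods pulled back from the matrices, `W` is a continuous function of its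
  -- projection; hence these neighbourhoods are as fine as those of the manifold topology.
  have hev : ∀ᶠ W in comap projFun (𝓝 (projFun V)),
      (chartAt (Fin m → Fin (n - m) → K) V).symm (projCoord (pivots V) (projFun W)) = W := by
    have h1 : {Q | IsUnit (cornerBlock (pivots V) Q)} ∈ 𝓝 (projFun V) :=
      (isOpen_isUnit_cornerBlock (pivots V)).mem_nhds hu
    filter_upwards [preimage_mem_comap h1] with W hW
    exact ofMatrix_projCoord hW
  have h2 : Tendsto (fun W : Gr K n m => (chartAt (Fin m → Fin (n - m) → K) V).symm
      (projCoord (pivots V) (projFun W))) (comap projFun (𝓝 (projFun V))) (𝓝 V) := by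
    have h3 : ContinuousAt (chartAt (Fin m → Fin (n - m) → K) V).symm
        (projCoord (pivots V) (projFun V)) :=
      (chartAt (Fin m → Fin (n - m) → K) V).continuousAt_symm (mem_univ _)
    have h4 := h3.tendsto.comp
      ((contDiffAt_projCoord hu).continuousAt.tendsto.comp
        (tendsto_comap (f := (projFun : Gr K n m → Fin n → Fin n → K))))
    rwa [chartAt_symm_apply, ofMatrix_projCoord hu] at h4
  exact (tendsto_congr' hev).1 h2

lemma isSmoothEmbedding_projFun : IsSmoothEmbedding (Fin m → Fin (n - m) → K)
    (Fin n → Fin n → K) (projFun : Gr K n m → Fin n → Fin n → K) :=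
  ⟨contMDiff_projFun, injective_mfderiv_projFun, isEmbedding_projFun⟩

end GrSmooth

/-! ### Compactness of the Grassmannian -/

section Compact

variable {K : Type*} [NormedDivisionRing K] [NormedAlgebra ℝ K] [FiniteDimensional ℝ K]
  [StarRing K] [HermitianAlgebra K] {n m : ℕ}

/-- Every Hermitian idempotent is the projection onto its own range, and its real trace is its rank.
The Grassmannian thus becomes a closed set of matrices. -/
lemma mem_range_proj_iff {Q : Matrix (Fin n) (Fin n) K} :
    Q ∈ range (proj : Gr K n m → Matrix (Fin n) (Fin n) K) ↔ Qᴴ = Q ∧ Q * Q = Q ∧ retr Q = m := by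
  constructor
  · rintro ⟨V, rfl⟩
    exact ⟨conjTranspose_proj V, proj_mul_self V, retr_proj V⟩
  · rintro ⟨h1, h2, h3⟩
    let S : Submodule K (Fin n → K) := LinearMap.range (Matrix.vecMulLinear Q)
    have hS : IsOrthProj S Q := by
      refine ⟨h1, fun x => ⟨x, rfl⟩, ?_⟩
      rintro _ ⟨x, rfl⟩
      change (x ᵥ* Q) ᵥ* Q = x ᵥ* Q
      rw [Matrix.vecMul_vecMul, h2]
    let V : Gr K n (finrank K S) := ⟨S, rfl⟩
    have hV : proj V = Q := (isOrthProj_proj V).eq hS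
    have h4 := retr_proj V
    rw [hV, h3] at h4
    have h5 : finrank K S = m := (Nat.cast_injective h4).symm
    exact ⟨⟨S, h5⟩, (isOrthProj_proj _).eq hS⟩

lemma continuous_re : Continuous (re : K → ℝ) :=
  (re : K →ₗ[ℝ] ℝ).continuous_of_finiteDimensional

lemma isCompact_range_projFun : IsCompact (range (projFun : Gr K n m → Fin n → Fin n → K)) := by
  have : ProperSpace K := FiniteDimensional.proper_real K
  have hstar : Continuous (star : K → K) := contDiff_star.continuous
  have hset : range (projFun : Gr K n m → Fin n → Fin n → K) =
      {Q | ∀ i j, star (Q j i) = Q i j} ∩ {Q | ∀ i j, ∑ k, Q i k * Q k j = Q i j} ∩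
        {Q | ∑ i, re (Q i i) = m} := by
    ext Q
    rw [show Q ∈ range (projFun : Gr K n m → Fin n → Fin n → K) ↔
      Matrix.of Q ∈ range (proj : Gr K n m → Matrix (Fin n) (Fin n) K) from Iff.rfl,
      mem_range_proj_iff, retr_apply, ← and_assoc, ← Matrix.ext_iff, ← Matrix.ext_iff]
    simp [Matrix.mul_apply]
  refine Metric.isCompact_of_isClosed_isBounded ?_ ?_
  · rw [hset]
    refine IsClosed.inter (IsClosed.inter ?_ ?_) ?_
    · simp only [ofPred_forall]
      exact isClosed_iInter fun i => isClosed_iInter fun j =>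
        isClosed_eq (hstar.comp (continuous_apply_apply j i)) (continuous_apply_apply i j)
    · simp only [ofPred_forall]
      exact isClosed_iInter fun i => isClosed_iInter fun j =>
        isClosed_eq (by fun_prop) (continuous_apply_apply i j)
    · exact isClosed_eq (continuous_finsetSum _ fun i _ =>
        continuous_re.comp (continuous_apply_apply i i)) continuous_const
  · refine (Metric.isBounded_closedBall (x := 0) (r := (m : ℝ) + 1)).subset ?_
    rintro _ ⟨V, rfl⟩
    have h1 : ∑ i, ∑ j, ‖proj V i j‖ ^ 2 = m := by
      rw [← retr_mul_conjTranspose, conjTranspose_proj, proj_mul_self, retr_proj]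
    rw [mem_closedBall_zero_iff, pi_norm_le_iff_of_nonneg (by positivity)]
    intro i
    rw [pi_norm_le_iff_of_nonneg (by positivity)]
    intro j
    have h2 : ‖proj V i j‖ ^ 2 ≤ m := by
      rw [← h1]
      refine (Finset.single_le_sum (f := fun j => ‖proj V i j‖ ^ 2) (fun _ _ => by positivity)
        (Finset.mem_univ j)).trans ?_
      exact Finset.single_le_sum (f := fun i => ∑ j, ‖proj V i j‖ ^ 2) (fun _ _ => by positivity)
        (Finset.mem_univ i)
    change ‖proj V i j‖ ≤ _
    nlinarith [norm_nonneg (proj V i j), sq_nonneg (‖proj V i j‖ - 1)]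

instance : CompactSpace (Gr K n m) := by
  rw [← isCompact_univ_iff, isEmbedding_projFun.isCompact_iff, image_univ]
  exact isCompact_range_projFun

end Compact

/-! ### Traceless Hermitian matrices -/

section Hermitian

variable (K : Type*) [NormedDivisionRing K] [NormedAlgebra ℝ K] [FiniteDimensional ℝ K]
  [StarRing K] [HermitianAlgebra K] (n : ℕ)

/-- The real vector space of Hermitian matrices. -/
def hermitian : Submodule ℝ (Matrix (Fin n) (Fin n) K) where
  carrier := {A | Aᴴ = A}
  add_mem' {A B} hA hB := by
    rw [mem_ofPred_eq] at *
    rw [conjTranspose_add, hA, hB]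
  zero_mem' := conjTranspose_zero
  smul_mem' r A hA := by
    rw [mem_ofPred_eq] at *
    rw [conjTranspose_smul, star_trivial, hA]

/-- A Hermitian matrix is given by its real diagonal and its upper triangular part. -/
def hermitianEquiv : hermitian K n ≃ₗ[ℝ] (Fin n → ℝ) × (∀ j : Fin n, Fin j → K) where
  toFun A := (fun i => re (A.1 i i), fun j i => A.1 (Fin.castLE j.2.le i) j)
  map_add' A B := by ext <;> simp
  map_smul' r A := by ext <;> simp
  invFun p := ⟨Matrix.of fun i j =>
    if h : i < j then p.2 j ⟨i, h⟩ else if h : j < i then star (p.2 i ⟨j, h⟩)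
      else algebraMap ℝ K (p.1 i), by
    change _ᴴ = _
    ext i j
    simp only [Matrix.conjTranspose_apply, Matrix.of_apply]
    rcases lt_trichotomy i j with h | rfl | h
    · rw [dif_neg h.not_gt, dif_pos h, dif_pos h, star_star]
    · simp [star_algebraMap]
    · rw [dif_pos h, dif_neg h.not_gt, dif_pos h]⟩
  left_inv A := by
    have hA : ∀ i j, star (A.1 j i) = A.1 i j := fun i j => congrFun (congrFun A.2 i) j
    apply Subtype.ext
    ext i j
    simp only [Matrix.of_apply]
    rcases lt_trichotomy i j with h | rfl | h
    · rw [dif_pos h]; rfl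
    · rw [dif_neg (lt_irrefl _), dif_neg (lt_irrefl _)]
      exact (eq_algebraMap_of_star_eq _ (hA i i)).symm
    · rw [dif_neg h.not_gt, dif_pos h]
      exact hA i j
  right_inv p := by
    refine Prod.ext ?_ ?_
    · funext i
      simp [re_algebraMap]
    · funext j i
      have h : Fin.castLE j.2.le i < j := i.2
      simp only [Matrix.of_apply]
      rw [dif_pos h]
      rfl

lemma finrank_hermitian : finrank ℝ (hermitian K n) = n + n * (n - 1) / 2 * finrank ℝ K := by
  rw [(hermitianEquiv K n).finrank_eq, finrank_prod, finrank_pi_fintype, finrank_pi_fintype]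
  simp only [finrank_self, finrank_pi_fintype, Finset.sum_const, Finset.card_univ,
    Fintype.card_fin, smul_eq_mul, mul_one]
  rw [← Finset.sum_mul, Fin.sum_univ_eq_sum_range (fun i => i), Finset.sum_range_id]

/-- The real trace of Hermitian matrices. -/
def hermitianTrace : hermitian K n →ₗ[ℝ] ℝ := retr.domRestrict (hermitian K n)

lemma finrank_ker_hermitianTrace (hn : 1 ≤ n) :
    finrank ℝ (LinearMap.ker (hermitianTrace K n)) + 1 = n + n * (n - 1) / 2 * finrank ℝ K := by
  have hsurj : LinearMap.range (hermitianTrace K n) = ⊤ := by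
    refine LinearMap.range_eq_top.2 (LinearMap.surjective fun h => ?_)
    have h1 : (1 : Matrix (Fin n) (Fin n) K) ∈ hermitian K n := conjTranspose_one
    have h2 : retr (1 : Matrix (Fin n) (Fin n) K) = 0 := congrArg (fun f => f ⟨1, h1⟩) h
    rw [retr_one, Fintype.card_fin] at h2
    have : n = 0 := by exact_mod_cast h2
    omega
  have h := LinearMap.finrank_range_add_finrank_ker (hermitianTrace K n)
  rw [hsurj, finrank_top, finrank_self, finrank_hermitian] at h
  omega

variable {K n}

/-- A linear isometric parametrization of the traceless Hermitian matrices by a Euclidean space,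
together with a linear left inverse. -/
structure HermitianParametrization (K : Type*) [NormedDivisionRing K] [NormedAlgebra ℝ K]
    [StarRing K] [HermitianAlgebra K] (n d : ℕ) where
  /-- The parametrization. -/
  toMatrix : EuclideanSpace ℝ (Fin d) →ₗ[ℝ] (Fin n → Fin n → K)
  /-- The left inverse. -/
  ofMatrix : (Fin n → Fin n → K) →ₗ[ℝ] EuclideanSpace ℝ (Fin d)
  conjTranspose_toMatrix : ∀ x, (Matrix.of (toMatrix x))ᴴ = Matrix.of (toMatrix x)
  retr_toMatrix : ∀ x, retr (Matrix.of (toMatrix x)) = 0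
  ofMatrix_toMatrix : ∀ x, ofMatrix (toMatrix x) = x
  toMatrix_ofMatrix : ∀ A : Matrix (Fin n) (Fin n) K, Aᴴ = A → retr A = 0 →
    toMatrix (ofMatrix A) = A
  norm_sq : ∀ x, ‖x‖ ^ 2 = retr (Matrix.of (toMatrix x) * Matrix.of (toMatrix x))

lemma nonempty_hermitianParametrization (hn : 1 ≤ n) {d : ℕ}
    (hd : d + 1 = n + n * (n - 1) / 2 * finrank ℝ K) :
    Nonempty (HermitianParametrization K n d) := by
  have hrank : finrank ℝ (LinearMap.ker (hermitianTrace K n)) = d := by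
    have := finrank_ker_hermitianTrace K n hn
    omega
  have hstar : ∀ x : LinearMap.ker (hermitianTrace K n), (x.1.1)ᴴ = x.1.1 := fun x => x.1.2
  let J : LinearMap.ker (hermitianTrace K n) →ₗ[ℝ] Matrix (Fin n) (Fin n) K :=
    (hermitian K n).subtype ∘ₗ (LinearMap.ker (hermitianTrace K n)).subtype
  let B : LinearMap.ker (hermitianTrace K n) →ₗ[ℝ] LinearMap.ker (hermitianTrace K n) →ₗ[ℝ] ℝ :=
    ((LinearMap.mul ℝ (Matrix (Fin n) (Fin n) K)).compr₂ retr).compl₁₂ J J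
  have hB : ∀ x y, B x y = retr (x.1.1 * y.1.1) := fun x y => rfl
  have hBself : ∀ x, B x x = retr (x.1.1 * x.1.1ᴴ) := fun x => by rw [hB, hstar]
  obtain ⟨e, he⟩ := exists_linearEquiv_euclideanSpace hrank B
    (fun x y => retr_mul_comm x.1.1 y.1.1)
    (fun x => (hBself x).symm ▸ retr_mul_conjTranspose_nonneg _)
    (fun x hx => Subtype.ext (Subtype.ext (eq_zero_of_retr_mul_conjTranspose (hBself x ▸ hx))))
  let R : EuclideanSpace ℝ (Fin d) →ₗ[ℝ] (Fin n → Fin n → K) :=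
    (Matrix.ofLinearEquiv ℝ).symm.toLinearMap ∘ₗ J ∘ₗ e.symm.toLinearMap
  have hR : ∀ x, Matrix.of (R x) = (e.symm x).1.1 := fun x => rfl
  have hinj : LinearMap.ker R = ⊥ := by
    refine LinearMap.ker_eq_bot.2 fun x y hxy => e.symm.injective ?_
    exact Subtype.ext (Subtype.ext hxy)
  obtain ⟨L, hL⟩ := R.exists_leftInverse_of_injective hinj
  have hLR : ∀ x, L (R x) = x := fun x => congrArg (fun f => f x) hL
  refine ⟨⟨R, L, fun x => ?_, fun x => (e.symm x).2, hLR, fun A hA hA0 => ?_, fun x => ?_⟩⟩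
  · rw [hR, hstar]
  · have h1 : R (e ⟨⟨A, hA⟩, hA0⟩) = A := by
      change Matrix.of (R _) = _
      rw [hR, e.symm_apply_apply]
    rw [← h1, hLR]
  · have := he (e.symm x)
    rwa [e.apply_symm_apply] at this

end Hermitian

/-! ### Transporting structures along homeomorphisms and quotient maps -/

section Transport

/-- Applied to the two maps out of weighted flags, this compares the flag join with the sphere
without constructing an inverse by hand. -/
lemma exists_homeomorph_of_isQuotientMap {X Y Z : Type*} [TopologicalSpace X] [TopologicalSpace Y]
    [TopologicalSpace Z] {f : X → Y} {g : X → Z} (hf : IsQuotientMap f) (hg : IsQuotientMap g)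
    (h : ∀ x y, f x = f y ↔ g x = g y) : ∃ e : Y ≃ₜ Z, ∀ x, e (f x) = g x := by
  obtain ⟨a, ha⟩ : ∃ a : Y → Z, ∀ x, a (f x) = g x :=
    ⟨g ∘ Function.surjInv hf.surjective, fun x =>
      (h _ _).1 (Function.surjInv_eq hf.surjective (f x))⟩
  obtain ⟨b, hb⟩ : ∃ b : Z → Y, ∀ x, b (g x) = f x :=
    ⟨f ∘ Function.surjInv hg.surjective, fun x =>
      (h _ _).2 (Function.surjInv_eq hg.surjective (g x))⟩
  have ha' : a ∘ f = g := funext ha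
  have hb' : b ∘ g = f := funext hb
  refine ⟨⟨⟨a, b, hf.surjective.forall.2 fun x => ?_, hg.surjective.forall.2 fun x => ?_⟩,
    hf.continuous_iff.2 (ha' ▸ hg.continuous), hg.continuous_iff.2 (hb' ▸ hf.continuous)⟩, ha⟩
  · rw [ha, hb]
  · rw [hb, ha]

lemma exists_manifold_of_homeomorph {E : Type*} [NormedAddCommGroup E] [NormedSpace ℝ E]
    {X M : Type*} [TopologicalSpace X] [TopologicalSpace M] [ChartedSpace E M]
    [IsManifold 𝓘(ℝ, E) ∞ M] (h : X ≃ₜ M) :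
    ∃ _ : ChartedSpace E X, IsManifold 𝓘(ℝ, E) ∞ X ∧ ContMDiff 𝓘(ℝ, E) 𝓘(ℝ, E) ∞ h ∧
      ContMDiff 𝓘(ℝ, E) 𝓘(ℝ, E) ∞ h.symm := by
  let cs : ChartedSpace E X :=
    { atlas := (fun c => h.transOpenPartialHomeomorph c) '' atlas E M
      chartAt := fun x => h.transOpenPartialHomeomorph (chartAt E (h x))
      mem_chart_source := fun x => mem_chart_source E (h x)
      chart_mem_atlas := fun x => ⟨_, chart_mem_atlas E (h x), rfl⟩ }
  have hm : IsManifold 𝓘(ℝ, E) ∞ X := by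
    refine @IsManifold.mk _ _ _ _ _ _ _ _ _ _ _ cs ⟨?_⟩
    rintro _ _ ⟨c, hc, rfl⟩ ⟨c', hc', rfl⟩
    refine (contDiffGroupoid ∞ 𝓘(ℝ, E)).mem_of_eqOnSource
      (HasGroupoid.compatible (G := contDiffGroupoid ∞ 𝓘(ℝ, E)) hc hc') ⟨?_, ?_⟩
    · ext y
      simp
    · intro y _
      simp
  refine ⟨cs, hm, fun x => ?_, fun y => ?_⟩
  · have h1 : ContMDiffAt 𝓘(ℝ, E) 𝓘(ℝ, E) ∞ (chartAt E x) x :=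
      contMDiffOn_chart.contMDiffAt (chart_source_mem_nhds E x)
    -- The charts of `X` are those of `M` precomposed with `h`, so in charts `h` is the identity;
    -- the same holds for its inverse.
    have h2 : ContMDiffAt 𝓘(ℝ, E) 𝓘(ℝ, E) ∞ (chartAt E (h x)).symm (chartAt E x x) :=
      contMDiffOn_chart_symm.contMDiffAt
        ((chartAt E (h x)).open_target.mem_nhds (mem_chart_target E (h x)))
    refine (h2.comp x h1).congr_of_eventuallyEq ?_
    filter_upwards [chart_source_mem_nhds E x] with z hz
    exact ((chartAt E (h x)).left_inv hz).symm
  · have h1 : ContMDiffAt 𝓘(ℝ, E) 𝓘(ℝ, E) ∞ (chartAt E y) y :=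
      contMDiffOn_chart.contMDiffAt (chart_source_mem_nhds E y)
    have hc : chartAt E (h.symm y) = h.transOpenPartialHomeomorph (chartAt E y) := by
      change h.transOpenPartialHomeomorph (chartAt E (h (h.symm y))) = _
      rw [h.apply_symm_apply]
    have hmem : chartAt E y y ∈ (chartAt E (h.symm y)).target := by
      rw [hc]
      exact mem_chart_target E y
    have h2 : ContMDiffAt 𝓘(ℝ, E) 𝓘(ℝ, E) ∞ (chartAt E (h.symm y)).symm (chartAt E y y) :=
      contMDiffOn_chart_symm.contMDiffAt
        ((chartAt E (h.symm y)).open_target.mem_nhds hmem)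
    refine (h2.comp y h1).congr_of_eventuallyEq ?_
    filter_upwards [chart_source_mem_nhds E y] with z hz
    rw [hc]
    exact congrArg h.symm ((chartAt E y).left_inv hz).symm

end Transport

/-! ### Convex combinations -/

section Convex

variable {κ E : Type*} [Fintype κ] [AddCommGroup E] [Module ℝ E]

lemma mem_convexHull_image_iff {v : κ → E} {C : Set κ} {p : E} :
    p ∈ convexHull ℝ (v '' C) ↔
      ∃ t ∈ stdSimplex ℝ κ, (∀ i ∉ C, t i = 0) ∧ ∑ i, t i • v i = p := by
  classical
  constructor
  · intro hp
    have hconv : Convex ℝ (stdSimplex ℝ κ ∩ {t | ∀ i ∉ C, t i = 0}) := by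
      refine (convex_stdSimplex ℝ κ).inter fun s hs t ht a b _ _ _ i hi => ?_
      simp [hs i hi, ht i hi]
    have hsub : convexHull ℝ (v '' C) ⊆
        Fintype.linearCombination ℝ v '' (stdSimplex ℝ κ ∩ {t | ∀ i ∉ C, t i = 0}) := by
      refine convexHull_min ?_ (hconv.linear_image _)
      rintro _ ⟨i, hi, rfl⟩
      refine ⟨Pi.single i 1, ⟨single_mem_stdSimplex ℝ i, fun j hj => ?_⟩, ?_⟩
      · exact Pi.single_eq_of_ne (by rintro rfl; exact hj hi) _
      · simp
    obtain ⟨t, ⟨ht, htC⟩, rfl⟩ := hsub hp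
    exact ⟨t, ht, htC, rfl⟩
  · rintro ⟨t, ht, htC, rfl⟩
    have h1 : ∑ i with t i ≠ 0, t i = 1 := by
      rw [Finset.sum_filter_ne_zero, ht.2]
    have h2 : ∑ i with t i ≠ 0, t i • v i = ∑ i, t i • v i :=
      Finset.sum_filter_of_ne fun i _ hi h0 => hi (by rw [h0, zero_smul])
    rw [← h2]
    refine (convex_convexHull ℝ _).sum_mem (fun i _ => ht.1 i) h1 fun i hi => ?_
    refine subset_convexHull ℝ _ ⟨i, ?_, rfl⟩
    by_contra hiC
    exact (Finset.mem_filter.1 hi).2 (htC i hiC)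

lemma mem_convexHull_range_iff {v : κ → E} {p : E} :
    p ∈ convexHull ℝ (range v) ↔ ∃ t ∈ stdSimplex ℝ κ, ∑ i, t i • v i = p := by
  rw [← image_univ, mem_convexHull_image_iff]
  simp

lemma eq_of_sum_smul_eq_of_affineIndependent {v : κ → E} (hv : AffineIndependent ℝ v)
    {s t : κ → ℝ} (hs : s ∈ stdSimplex ℝ κ) (ht : t ∈ stdSimplex ℝ κ)
    (h : ∑ i, s i • v i = ∑ i, t i • v i) : s = t := by
  rw [affineIndependent_iff] at hv
  funext i
  refine sub_eq_zero.1 (hv Finset.univ (fun i => s i - t i) ?_ ?_ i (Finset.mem_univ i))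
  · rw [Finset.sum_sub_distrib, hs.2, ht.2, sub_self]
  · simp only [sub_smul, Finset.sum_sub_distrib, h, sub_self]

end Convex

/-! ### The projections are in general position -/

section Existence

variable {K : Type*} [NormedDivisionRing K] [NormedAlgebra ℝ K] [FiniteDimensional ℝ K]
  [StarRing K] [HermitianAlgebra K] {n M : ℕ}

lemma contMDiff_linearMap {E F : Type*} [NormedAddCommGroup E] [NormedSpace ℝ E]
    [FiniteDimensional ℝ E] [NormedAddCommGroup F] [NormedSpace ℝ F] (L : E →ₗ[ℝ] F) :
    ContMDiff 𝓘(ℝ, E) 𝓘(ℝ, F) ∞ L :=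
  L.toContinuousLinearMap.contDiff.contMDiff

lemma isSmoothEmbedding_linearMap_comp_projFun {m : ℕ} {E : Type*} [NormedAddCommGroup E]
    [NormedSpace ℝ E] [FiniteDimensional ℝ E] {L : (Fin n → Fin n → K) →ₗ[ℝ] E}
    (hL : Function.Injective L) :
    IsSmoothEmbedding (Fin m → Fin (n - m) → K) E (fun V : Gr K n m => L (projFun V)) := by
  obtain ⟨L', hL'⟩ := L.exists_leftInverse_of_injective (LinearMap.ker_eq_bot.2 hL)
  refine IsSmoothEmbedding.of_comp ((contMDiff_linearMap L).comp contMDiff_projFun)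
    (contMDiff_linearMap L') ?_
  have h : L' ∘ (fun V : Gr K n m => L (projFun V)) = projFun :=
    funext fun V => congrArg (fun f => f (projFun V)) hL'
  rw [h]
  exact isSmoothEmbedding_projFun

/-- Splitting the coefficients into positive and negative parts turns a linear relation into an
equality of two nonnegative combinations, to which uniqueness applies. -/
lemma linearIndependent_proj (F : CompleteFlag K n) :
    LinearIndependent ℝ fun i => proj (F.space i) := by
  rw [Fintype.linearIndependent_iff]
  intro g hg i
  have h1 : ∑ i, (g i)⁺ • proj (F.space i) =
      ∑ i, (g i)⁻ • proj (F.space i) + (0 : ℝ) • 1 := by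
    rw [zero_smul, add_zero, ← sub_eq_zero, ← Finset.sum_sub_distrib]
    simp only [← sub_smul, posPart_sub_negPart]
    exact hg
  have h2 := congrFun (eq_of_sum_smul_proj_eq (fun i => posPart_nonneg _)
    (fun i => negPart_nonneg _) h1).1 i
  rw [← posPart_sub_negPart (g i), h2, sub_self]

lemma generalPosition_projFun {L : (Fin n → Fin n → K) →ₗ[ℝ] EuclideanSpace ℝ (Fin M)}
    (hL : Function.Injective L) :
    GeneralPosition (K := K) fun _ V => L (projFun V) where
  isEmbedding i := (isSmoothEmbedding_linearMap_comp_projFun hL).2.2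
  disjoint i j hij := by
    rw [Set.disjoint_left]
    rintro _ ⟨V, rfl⟩ ⟨W, hW⟩
    have h1 : proj W = proj V := hL hW
    have h2 := congrArg retr h1
    rw [retr_proj, retr_proj] at h2
    have h3 : (j : ℕ) + 1 = i + 1 := by exact_mod_cast h2
    exact hij (Fin.ext (by omega))
  affineIndependent F := by
    refine LinearIndependent.affineIndependent ℝ ?_
    exact LinearIndependent.map' (linearIndependent_proj F) L (LinearMap.ker_eq_bot.2 hL)
  inter_subset F F' := by
    rintro p ⟨hp, hp'⟩
    obtain ⟨t, ht, rfl⟩ := mem_convexHull_range_iff.1 hp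
    obtain ⟨t', ht', h⟩ := mem_convexHull_range_iff.1 hp'
    simp only [← map_smul, ← map_sum] at h
    have h1 : ∑ i, t i • proj (F.space i) = ∑ i, t' i • proj (F'.space i) + (0 : ℝ) • 1 := by
      rw [zero_smul, add_zero]
      exact (hL h).symm
    obtain ⟨-, h3⟩ := eq_of_sum_smul_proj_eq ht.1 ht'.1 h1
    -- By uniqueness the two flags agree wherever the weight is nonzero, so only common vertices
    -- contribute.
    refine convexHull_mono ?_ (mem_convexHull_image_iff (C := {i | t i ≠ 0}).2
      ⟨t, ht, fun i hi => not_not.1 hi, rfl⟩)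
    rintro _ ⟨i, hi, rfl⟩
    exact ⟨⟨i, rfl⟩, ⟨i, congrArg (fun V => L (projFun V)) (h3 i hi).symm⟩⟩

lemma exists_injective_linearMap_euclideanSpace {V : Type*} [AddCommGroup V] [Module ℝ V]
    [FiniteDimensional ℝ V] (h : finrank ℝ V ≤ M) :
    ∃ L : V →ₗ[ℝ] EuclideanSpace ℝ (Fin M), Function.Injective L := by
  exact finrank_le_iff_exists_linearMap.1 (h.trans_eq (by simp))

end Existence

/-! ### Weighted flags -/

section WeightedFlags

variable {K : Type*} [NormedDivisionRing K] [NormedAlgebra ℝ K] [FiniteDimensional ℝ K]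
  [StarRing K] [HermitianAlgebra K] {n M : ℕ}

/-- Complete flags with barycentric weights. -/
def WeightedFlag (K : Type*) [DivisionRing K] (n : ℕ) : Type _ :=
  {x : (∀ i : Fin (n - 1), Gr K n (i + 1)) × (Fin (n - 1) → ℝ) //
    (∀ i j, i ≤ j → (x.1 i).1 ≤ (x.1 j).1) ∧ x.2 ∈ stdSimplex ℝ (Fin (n - 1))}

namespace WeightedFlag

/-- The underlying flag. -/
def flag (x : WeightedFlag K n) : CompleteFlag K n := ⟨x.1.1, x.2.1⟩

/-- The weights. -/
def weight (x : WeightedFlag K n) : Fin (n - 1) → ℝ := x.1.2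

lemma weight_mem (x : WeightedFlag K n) : x.weight ∈ stdSimplex ℝ (Fin (n - 1)) := x.2.2

/-- The weighted flag with given flag and weights. -/
def mk (F : CompleteFlag K n) (t : Fin (n - 1) → ℝ) (ht : t ∈ stdSimplex ℝ (Fin (n - 1))) :
    WeightedFlag K n := ⟨(F.space, t), F.mono, ht⟩

/-- Two weighted flags agree up to the subspaces of weight zero. -/
def Equivalent (x y : WeightedFlag K n) : Prop :=
  x.weight = y.weight ∧ ∀ i, x.weight i ≠ 0 → x.flag.space i = y.flag.space i

lemma Equivalent.sum_eq {x y : WeightedFlag K n} (h : x.Equivalent y) {E : Type*}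
    [AddCommGroup E] [Module ℝ E] (v : ∀ i : Fin (n - 1), Gr K n (i + 1) → E) :
    ∑ i, x.weight i • v i (x.flag.space i) = ∑ i, y.weight i • v i (y.flag.space i) := by
  refine Finset.sum_congr rfl fun i _ => ?_
  rw [← h.1]
  by_cases hi : x.weight i = 0
  · rw [hi, zero_smul, zero_smul]
  · rw [h.2 i hi]

instance : TopologicalSpace (WeightedFlag K n) := instTopologicalSpaceSubtype

lemma continuous_weight (i : Fin (n - 1)) : Continuous fun x : WeightedFlag K n => x.weight i :=
  (continuous_apply i).comp (continuous_snd.comp continuous_subtype_val)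

lemma continuous_space (i : Fin (n - 1)) :
    Continuous fun x : WeightedFlag K n => x.flag.space i :=
  (continuous_apply i).comp (continuous_fst.comp continuous_subtype_val)

instance : CompactSpace (WeightedFlag K n) := by
  refine isCompact_iff_compactSpace.1 (IsCompact.of_isClosed_subset
    (isCompact_univ.prod (isCompact_stdSimplex ℝ (Fin (n - 1)))) ?_ fun x hx => ⟨trivial, hx.2⟩)
  -- Inclusion of subspaces is the closed condition `P_V P_W = P_V`.
  have hset : {x : (∀ i : Fin (n - 1), Gr K n (i + 1)) × (Fin (n - 1) → ℝ) |
      (∀ i j, i ≤ j → (x.1 i).1 ≤ (x.1 j).1) ∧ x.2 ∈ stdSimplex ℝ (Fin (n - 1))} =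
      (⋂ (i) (j) (_ : i ≤ j) (a) (b),
        {x : (∀ i : Fin (n - 1), Gr K n (i + 1)) × (Fin (n - 1) → ℝ) |
          ∑ k, projFun (x.1 i) a k * projFun (x.1 j) k b = projFun (x.1 i) a b}) ∩ Prod.snd ⁻¹' stdSimplex ℝ (Fin (n - 1)) := by
    ext x
    simp only [mem_ofPred_eq, mem_inter_iff, mem_iInter, mem_preimage, ← proj_mul_proj_eq_iff,
      ← Matrix.ext_iff, Matrix.mul_apply]
    rfl
  have hcont : ∀ i a b, Continuous
      fun x : (∀ i : Fin (n - 1), Gr K n (i + 1)) × (Fin (n - 1) → ℝ) => projFun (x.1 i) a b :=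
    fun i a b => (continuous_apply_apply a b).comp
      (isEmbedding_projFun.continuous.comp ((continuous_apply i).comp continuous_fst))
  change IsClosed {x : (∀ i : Fin (n - 1), Gr K n (i + 1)) × (Fin (n - 1) → ℝ) |
      (∀ i j, i ≤ j → (x.1 i).1 ≤ (x.1 j).1) ∧ x.2 ∈ stdSimplex ℝ (Fin (n - 1))}
  rw [hset]
  refine IsClosed.inter ?_ ((isClosed_stdSimplex ℝ _).preimage continuous_snd)
  refine isClosed_iInter fun i => isClosed_iInter fun j => isClosed_iInter fun _ =>
    isClosed_iInter fun a => isClosed_iInter fun b => isClosed_eq ?_ (hcont i a b)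
  exact continuous_finsetSum _ fun k _ => (hcont i a k).mul (hcont j k b)

end WeightedFlag

/-- The point of the flag join with given barycentric coordinates. -/
def toFlagJoin (ι : ∀ i : Fin (n - 1), Gr K n (i + 1) → EuclideanSpace ℝ (Fin M))
    (x : WeightedFlag K n) : flagJoin ι :=
  ⟨∑ i, x.weight i • ι i (x.flag.space i),
    mem_iUnion.2 ⟨x.flag, mem_convexHull_range_iff.2 ⟨x.weight, x.weight_mem, rfl⟩⟩⟩

namespace GeneralPosition

variable {ι : ∀ i : Fin (n - 1), Gr K n (i + 1) → EuclideanSpace ℝ (Fin M)}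

lemma eq_of_eq (hι : GeneralPosition ι) {i j : Fin (n - 1)} {V : Gr K n (i + 1)}
    {W : Gr K n (j + 1)} (h : ι i V = ι j W) : ∃ hij : i = j, hij ▸ V = W := by
  have hij : i = j := by
    by_contra hij
    exact Set.disjoint_left.1 (hι.disjoint i j hij) ⟨V, rfl⟩ ⟨W, h.symm⟩
  subst hij
  exact ⟨rfl, (hι.isEmbedding i).injective h⟩

lemma toFlagJoin_eq_iff (hι : GeneralPosition ι) (x y : WeightedFlag K n) :
    toFlagJoin ι x = toFlagJoin ι y ↔ x.Equivalent y := by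
  constructor
  · intro h
    have hxy : ∑ i, x.weight i • ι i (x.flag.space i) = ∑ i, y.weight i • ι i (y.flag.space i) :=
      congrArg Subtype.val h
    have h1 := hι.inter_subset x.flag y.flag
      ⟨mem_convexHull_range_iff.2 ⟨x.weight, x.weight_mem, rfl⟩,
        mem_convexHull_range_iff.2 ⟨y.weight, y.weight_mem, hxy.symm⟩⟩
    have h2 : vertices ι x.flag ∩ vertices ι y.flag ⊆
        (fun i => ι i (x.flag.space i)) '' {i | x.flag.space i = y.flag.space i} := by
      rintro _ ⟨⟨i, rfl⟩, ⟨j, hj⟩⟩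
      obtain ⟨rfl, h3⟩ := hι.eq_of_eq hj.symm
      exact ⟨_, h3, rfl⟩
    -- The point has barycentric coordinates `s` supported on the common vertices. Affine
    -- independence in each simplex identifies `s` with both systems of weights.
    obtain ⟨s, hs, hsC, hsum⟩ := mem_convexHull_image_iff.1 (convexHull_mono h2 h1)
    have hx : s = x.weight :=
      eq_of_sum_smul_eq_of_affineIndependent (hι.affineIndependent x.flag) hs x.weight_mem hsum
    have hsum' : ∑ i, s i • ι i (y.flag.space i) = ∑ i, s i • ι i (x.flag.space i) := by
      refine Finset.sum_congr rfl fun i _ => ?_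
      by_cases hi : x.flag.space i = y.flag.space i
      · rw [hi]
      · rw [hsC i hi, zero_smul, zero_smul]
    have hy : s = y.weight :=
      eq_of_sum_smul_eq_of_affineIndependent (hι.affineIndependent y.flag) hs y.weight_mem
        (hsum'.trans (hsum.trans hxy))
    refine ⟨hx.symm.trans hy, fun i hi => ?_⟩
    by_contra hne
    exact hi (hx ▸ hsC i hne)
  · intro h
    exact Subtype.ext (h.sum_eq ι)

lemma isQuotientMap_toFlagJoin (hι : GeneralPosition ι) : IsQuotientMap (toFlagJoin ι) := by
  refine IsQuotientMap.of_surjective_continuous ?_ ?_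
  · rintro ⟨p, hp⟩
    obtain ⟨F, hF⟩ := mem_iUnion.1 hp
    obtain ⟨t, ht, rfl⟩ := mem_convexHull_range_iff.1 hF
    exact ⟨WeightedFlag.mk F t ht, rfl⟩
  · refine Continuous.subtype_mk (continuous_finsetSum _ fun i _ => ?_) _
    exact (WeightedFlag.continuous_weight i).smul
      ((hι.isEmbedding i).continuous.comp (WeightedFlag.continuous_space i))

end GeneralPosition

end WeightedFlags

/-! ### The sphere of traceless Hermitian matrices -/

section Sphere

variable {K : Type*} [NormedDivisionRing K] [NormedAlgebra ℝ K] [FiniteDimensional ℝ K]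
  [StarRing K] [HermitianAlgebra K] {n m d : ℕ}

/-- The traceless part of the orthogonal projection onto a subspace. -/
def centeredProj (V : Gr K n m) : Matrix (Fin n) (Fin n) K := proj V - ((m : ℝ) / n) • 1

lemma conjTranspose_centeredProj (V : Gr K n m) : (centeredProj V)ᴴ = centeredProj V := by
  rw [centeredProj, conjTranspose_sub, conjTranspose_smul, conjTranspose_one, star_trivial,
    conjTranspose_proj]

lemma retr_centeredProj (hn : n ≠ 0) (V : Gr K n m) : retr (centeredProj V) = 0 := by
  have hn' : (n : ℝ) ≠ 0 := by exact_mod_cast hn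
  rw [centeredProj, map_sub, map_smul, retr_proj, retr_one, Fintype.card_fin, smul_eq_mul]
  field_simp
  ring

/-- The norm is constant on the Grassmannian, so normalizing to the unit sphere is a mere rescaling
there. -/
lemma retr_centeredProj_mul_self (hn : n ≠ 0) (V : Gr K n m) :
    retr (centeredProj V * centeredProj V) = m * (n - m) / n := by
  have hn' : (n : ℝ) ≠ 0 := by exact_mod_cast hn
  have h : centeredProj V * centeredProj V = centeredProj V * proj V -
      ((m : ℝ) / n) • centeredProj V := by
    conv_lhs => rw [centeredProj.eq_def (V := V), mul_sub, mul_smul_comm, mul_one,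
      ← centeredProj.eq_def]
  rw [h, map_sub, map_smul, retr_centeredProj hn, smul_zero, sub_zero, centeredProj, sub_mul,
    proj_mul_self, smul_mul_assoc, one_mul, map_sub, map_smul, retr_proj, smul_eq_mul]
  field_simp

lemma sum_smul_centeredProj (F : CompleteFlag K n) (t : Fin (n - 1) → ℝ) :
    ∃ c : ℝ, ∑ i, t i • centeredProj (F.space i) = ∑ i, t i • proj (F.space i) + c • 1 := by
  refine ⟨-∑ i, t i * (((i + 1 : ℕ) : ℝ) / n), ?_⟩
  simp only [centeredProj, smul_sub, Finset.sum_sub_distrib, smul_smul, ← Finset.sum_smul]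
  rw [neg_smul, sub_eq_add_neg]

namespace HermitianParametrization

variable (Φ : HermitianParametrization K n d)

lemma toMatrix_ofMatrix_centeredProj (hn : n ≠ 0) (V : Gr K n m) :
    Φ.toMatrix (Φ.ofMatrix (centeredProj V)) = centeredProj V :=
  Φ.toMatrix_ofMatrix _ (conjTranspose_centeredProj V) (retr_centeredProj hn V)

lemma norm_sq_ofMatrix_centeredProj (hn : n ≠ 0) (V : Gr K n m) :
    ‖Φ.ofMatrix (centeredProj V)‖ ^ 2 = m * (n - m) / n := by
  rw [Φ.norm_sq, Φ.toMatrix_ofMatrix_centeredProj hn]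
  exact retr_centeredProj_mul_self hn V

lemma ofMatrix_centeredProj (V : Gr K n m) : Φ.ofMatrix (centeredProj V) =
    Φ.ofMatrix (projFun V) - ((m : ℝ) / n) • Φ.ofMatrix (1 : Matrix (Fin n) (Fin n) K) := by
  let one : Fin n → Fin n → K := (1 : Matrix (Fin n) (Fin n) K)
  exact (map_sub Φ.ofMatrix (projFun V) (((m : ℝ) / n) • one)).trans
    (congrArg _ (map_smul Φ.ofMatrix ((m : ℝ) / n) one))

lemma contMDiff_ofMatrix_centeredProj : ContMDiff 𝓘(ℝ, Fin m → Fin (n - m) → K)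
    𝓘(ℝ, EuclideanSpace ℝ (Fin d)) ∞ fun V : Gr K n m => Φ.ofMatrix (centeredProj V) := by
  simp only [ofMatrix_centeredProj]
  exact ((contMDiff_linearMap Φ.ofMatrix).comp contMDiff_projFun).sub contMDiff_const

/-- The traceless Hermitian matrix with given flag and eigenvalue gaps. -/
def combination (x : WeightedFlag K n) : EuclideanSpace ℝ (Fin d) :=
  ∑ i, x.weight i • Φ.ofMatrix (centeredProj (x.flag.space i))

lemma continuous_combination : Continuous Φ.combination :=
  continuous_finsetSum _ fun i _ => (WeightedFlag.continuous_weight i).smul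
    (Φ.contMDiff_ofMatrix_centeredProj.continuous.comp (WeightedFlag.continuous_space i))

lemma toMatrix_combination (hn : n ≠ 0) (x : WeightedFlag K n) :
    Φ.toMatrix (Φ.combination x) = ∑ i, x.weight i • centeredProj (x.flag.space i) := by
  rw [combination, map_sum]
  refine Finset.sum_congr rfl fun i _ => ?_
  rw [map_smul, Φ.toMatrix_ofMatrix_centeredProj hn]
  rfl

/-- Uniqueness up to scalar matrices gives the weights as `r` times the other weights, and both sum
to one. Allowing `r = 0` also shows that a combination never vanishes. -/
lemma eq_of_combination_eq_smul (hn : n ≠ 0) {x y : WeightedFlag K n} {r : ℝ} (hr : 0 ≤ r)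
    (h : Φ.combination x = r • Φ.combination y) : r = 1 ∧ x.Equivalent y := by
  have h1 := congrArg Φ.toMatrix h
  rw [map_smul, Φ.toMatrix_combination hn, Φ.toMatrix_combination hn] at h1
  obtain ⟨c, hc⟩ := sum_smul_centeredProj x.flag x.weight
  obtain ⟨c', hc'⟩ := sum_smul_centeredProj y.flag y.weight
  have h2 : ∑ i, x.weight i • proj (x.flag.space i) + c • 1 =
      r • (∑ i, y.weight i • proj (y.flag.space i) + c' • (1 : Matrix (Fin n) (Fin n) K)) := by
    rw [← hc, ← hc']
    exact h1
  have h3 : ∑ i, x.weight i • proj (x.flag.space i) =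
      ∑ i, (r * y.weight i) • proj (y.flag.space i) + (r * c' - c) • 1 := by
    rw [eq_sub_of_add_eq h2, smul_add, Finset.smul_sum, sub_smul]
    simp only [smul_smul]
    abel
  obtain ⟨h4, h5⟩ := eq_of_sum_smul_proj_eq x.weight_mem.1
    (fun i => mul_nonneg hr (y.weight_mem.1 i)) h3
  have h6 : r = 1 := by
    have h7 := x.weight_mem.2
    rw [h4, ← Finset.mul_sum, y.weight_mem.2, mul_one] at h7
    exact h7
  subst h6
  exact ⟨rfl, h4.trans (funext fun i => one_mul _), h5⟩

lemma combination_ne_zero (hn : n ≠ 0) (x : WeightedFlag K n) : Φ.combination x ≠ 0 := by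
  intro h
  have := (Φ.eq_of_combination_eq_smul hn le_rfl (h.trans (zero_smul ℝ (Φ.combination x)).symm)).1
  exact zero_ne_one this

/-- The unit traceless Hermitian matrix of a weighted flag. -/
def toSphere (hn : n ≠ 0) (x : WeightedFlag K n) :
    Metric.sphere (0 : EuclideanSpace ℝ (Fin d)) 1 :=
  ⟨‖Φ.combination x‖⁻¹ • Φ.combination x, by
    rw [mem_sphere_zero_iff_norm, norm_smul, norm_inv, norm_norm]
    exact inv_mul_cancel₀ (norm_ne_zero_iff.2 (Φ.combination_ne_zero hn x))⟩

lemma toSphere_eq_iff (hn : n ≠ 0) (x y : WeightedFlag K n) :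
    Φ.toSphere hn x = Φ.toSphere hn y ↔ x.Equivalent y := by
  constructor
  · intro h
    have h1 : ‖Φ.combination x‖⁻¹ • Φ.combination x = ‖Φ.combination y‖⁻¹ • Φ.combination y :=
      congrArg Subtype.val h
    have h2 : Φ.combination x = (‖Φ.combination x‖ * ‖Φ.combination y‖⁻¹) • Φ.combination y := by
      rw [mul_smul, ← h1, smul_inv_smul₀ (norm_ne_zero_iff.2 (Φ.combination_ne_zero hn x))]
    exact (Φ.eq_of_combination_eq_smul hn (by positivity) h2).2
  · intro h
    have h1 : Φ.combination x = Φ.combination y :=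
      h.sum_eq fun _ V => Φ.ofMatrix (centeredProj V)
    simp only [toSphere, h1]

lemma surjective_toSphere (hn : n ≠ 0) : Function.Surjective (Φ.toSphere hn) := by
  rintro ⟨z, hz⟩
  rw [mem_sphere_zero_iff_norm] at hz
  have hn' : (n : ℝ) ≠ 0 := by exact_mod_cast hn
  have hone : ∀ c : ℝ, retr (c • (1 : Matrix (Fin n) (Fin n) K)) = 0 → c = 0 := by
    intro c hc
    rw [map_smul, retr_one, Fintype.card_fin, smul_eq_mul] at hc
    exact (mul_eq_zero.1 hc).resolve_right hn'
  let A : Matrix (Fin n) (Fin n) K := Matrix.of (Φ.toMatrix z)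
  have hA0 : retr A = 0 := Φ.retr_toMatrix z
  obtain ⟨F, t, c, ht, hA⟩ := exists_flag_sum_smul_proj (by omega) (Φ.conjTranspose_toMatrix z)
  obtain ⟨c', hc'⟩ := sum_smul_centeredProj F t
  have hA1 : A = ∑ i, t i • centeredProj (F.space i) := by
    have h1 : A = ∑ i, t i • centeredProj (F.space i) + (c - c') • 1 := by
      rw [hc', sub_smul]
      refine hA.trans ?_
      abel
    -- The scalar part vanishes because all other terms are traceless.
    have h2 : c - c' = 0 := by
      refine hone _ ?_
      have h3 := congrArg retr h1
      rw [hA0, map_add, map_sum] at h3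
      simp only [map_smul, retr_centeredProj hn, smul_zero, Finset.sum_const_zero, zero_add] at h3
      rw [map_smul, h3]
    rw [h1, h2, zero_smul, add_zero]
  have hzA : z = ∑ i, t i • Φ.ofMatrix (centeredProj (F.space i)) := by
    let v : Fin (n - 1) → Fin n → Fin n → K := fun i => centeredProj (F.space i)
    have h1 : Φ.ofMatrix (∑ i, t i • v i) = ∑ i, t i • Φ.ofMatrix (v i) := by
      simp only [map_sum, map_smul]
    rw [← Φ.ofMatrix_toMatrix z]
    exact (congrArg Φ.ofMatrix hA1).trans h1
  have hT : 0 < ∑ i, t i := by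
    refine lt_of_le_of_ne (Finset.sum_nonneg fun i _ => ht i) fun h => ?_
    have h1 := (Finset.sum_eq_zero_iff_of_nonneg fun i _ => ht i).1 h.symm
    have h2 : z = 0 := by
      rw [hzA]
      exact Finset.sum_eq_zero fun i hi => by rw [h1 i hi, zero_smul]
    rw [h2, norm_zero] at hz
    exact zero_ne_one hz
  -- The gaps need not sum to one; dividing by their positive sum only rescales the matrix, and
  -- normalizing to the sphere undoes this.
  have hmem : (fun i => (∑ i, t i)⁻¹ * t i) ∈ stdSimplex ℝ (Fin (n - 1)) := by
    refine ⟨fun i => mul_nonneg (inv_nonneg.2 hT.le) (ht i), ?_⟩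
    rw [← Finset.mul_sum, inv_mul_cancel₀ hT.ne']
  refine ⟨WeightedFlag.mk F _ hmem, Subtype.ext ?_⟩
  have h1 : Φ.combination (WeightedFlag.mk F _ hmem) = (∑ i, t i)⁻¹ • z := by
    rw [hzA, Finset.smul_sum]
    simp only [smul_smul]
    rfl
  change ‖Φ.combination _‖⁻¹ • Φ.combination _ = z
  rw [h1, norm_smul, hz, mul_one, norm_inv, Real.norm_of_nonneg hT.le, inv_inv,
    smul_inv_smul₀ hT.ne']

lemma isQuotientMap_toSphere (hn : n ≠ 0) : IsQuotientMap (Φ.toSphere hn) := by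
  refine IsQuotientMap.of_surjective_continuous (Φ.surjective_toSphere hn) ?_
  refine Continuous.subtype_mk ?_ _
  exact (Φ.continuous_combination.norm.inv₀ fun x =>
    norm_ne_zero_iff.2 (Φ.combination_ne_zero hn x)).smul Φ.continuous_combination

end HermitianParametrization

lemma GeneralPosition.exists_homeomorph_sphere {M : ℕ}
    {ι : ∀ i : Fin (n - 1), Gr K n (i + 1) → EuclideanSpace ℝ (Fin M)} (hι : GeneralPosition ι)
    (hn : n ≠ 0) (Φ : HermitianParametrization K n d) :
    ∃ h : flagJoin ι ≃ₜ Metric.sphere (0 : EuclideanSpace ℝ (Fin d)) 1,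
      ∀ i V, (h (grEmbedding ι i V) : EuclideanSpace ℝ (Fin d)) =
        ‖Φ.ofMatrix (centeredProj V)‖⁻¹ • Φ.ofMatrix (centeredProj V) := by
  obtain ⟨h, hh⟩ := exists_homeomorph_of_isQuotientMap hι.isQuotientMap_toFlagJoin
    (Φ.isQuotientMap_toSphere hn)
    (fun x y => (hι.toFlagJoin_eq_iff x y).trans (Φ.toSphere_eq_iff hn x y).symm)
  refine ⟨h, fun i V => ?_⟩
  obtain ⟨F, rfl⟩ := exists_completeFlag i V
  -- A point of a Grassmannian is a vertex: all the weight sits on one member of any flag through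
  -- it.
  let x := WeightedFlag.mk F (Pi.single i 1) (single_mem_stdSimplex ℝ i)
  have hx : ∀ {E : Type} [AddCommGroup E] [Module ℝ E] (v : Fin (n - 1) → E),
      ∑ j, x.weight j • v j = v i := by
    intro E _ _ v
    change ∑ j, (Pi.single i (1 : ℝ) : Fin (n - 1) → ℝ) j • v j = v i
    rw [Finset.sum_eq_single i]
    · simp
    · intro j _ hj
      simp [hj]
    · simp
  have h1 : toFlagJoin ι x = grEmbedding ι i (F.space i) :=
    Subtype.ext (hx fun j => ι j (F.space j))
  have h2 : Φ.combination x = Φ.ofMatrix (centeredProj (F.space i)) :=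
    hx fun j => Φ.ofMatrix (centeredProj (F.space j))
  rw [← h1, hh, ← h2]
  rfl

lemma GeneralPosition.hasStandardSphereStructure {M N : ℕ}
    {ι : ∀ i : Fin (n - 1), Gr K n (i + 1) → EuclideanSpace ℝ (Fin M)} (hι : GeneralPosition ι)
    (hn : n ≠ 0) (Φ : HermitianParametrization K n (N + 1)) : HasStandardSphereStructure ι N := by
  have hpos : 0 < n := Nat.pos_of_ne_zero hn
  obtain ⟨h, hh⟩ := hι.exists_homeomorph_sphere hn Φ
  obtain ⟨cs, hcs, hsm, hsm'⟩ := exists_manifold_of_homeomorph (E := EuclideanSpace ℝ (Fin N)) h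
  refine ⟨cs, hcs, ⟨⟨h.toEquiv, hsm, hsm'⟩⟩, fun i => ?_⟩
  have hin : (i : ℕ) + 1 < n := by omega
  have hpos' : (0 : ℝ) < ((i + 1 : ℕ) : ℝ) * (n - (i + 1 : ℕ)) / n := by
    have h1 : ((i + 1 : ℕ) : ℝ) < n := by exact_mod_cast hin
    have h2 : (0 : ℝ) < n := by exact_mod_cast hpos
    have h3 : (0 : ℝ) < n - (i + 1 : ℕ) := sub_pos.2 h1
    positivity
  let ρ : ℝ := Real.sqrt (((i + 1 : ℕ) : ℝ) * (n - (i + 1 : ℕ)) / n)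
  have hρ : 0 < ρ := Real.sqrt_pos.2 hpos'
  have hnorm : ∀ V : Gr K n (i + 1), ‖Φ.ofMatrix (centeredProj V)‖ = ρ := fun V => by
    rw [← Real.sqrt_sq (norm_nonneg (Φ.ofMatrix (centeredProj V))),
      Φ.norm_sq_ofMatrix_centeredProj hn]
  have hcoe : ∀ V, (h (grEmbedding ι i V) : EuclideanSpace ℝ (Fin (N + 1))) =
      ρ⁻¹ • Φ.ofMatrix (centeredProj V) := fun V => by rw [hh, hnorm]
  have : Fact (finrank ℝ (EuclideanSpace ℝ (Fin (N + 1))) = N + 1) :=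
    ⟨finrank_euclideanSpace_fin⟩
  have hsphere : ContMDiff 𝓘(ℝ, Fin (i + 1) → Fin (n - (i + 1)) → K) (𝓡 N) ∞
      (h ∘ grEmbedding ι i) := by
    have h1 : ContMDiff 𝓘(ℝ, Fin (i + 1) → Fin (n - (i + 1)) → K)
        𝓘(ℝ, EuclideanSpace ℝ (Fin (N + 1))) ∞
        (fun V => (h (grEmbedding ι i V) : EuclideanSpace ℝ (Fin (N + 1)))) := by
      simp only [hcoe]
      exact (contMDiff_linearMap (ρ⁻¹ • LinearMap.id)).comp Φ.contMDiff_ofMatrix_centeredProj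
    exact h1.codRestrict_sphere fun V => (h (grEmbedding ι i V)).2
  have hgr : ContMDiff 𝓘(ℝ, Fin (i + 1) → Fin (n - (i + 1)) → K) (𝓡 N) ∞ (grEmbedding ι i) := by
    have h1 := hsm'.comp hsphere
    have h2 : h.symm ∘ h ∘ grEmbedding ι i = grEmbedding ι i :=
      funext fun V => h.symm_apply_apply _
    rwa [h2] at h1
  let one : Fin n → Fin n → K := (1 : Matrix (Fin n) (Fin n) K)
  -- Undoing the rescaling and the centering gives a smooth map on the whole flag join whose
  -- restriction to the Grassmannian is `projFun`.
  let g : flagJoin ι → Fin n → Fin n → K := fun y =>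
    ρ • Φ.toMatrix (h y : EuclideanSpace ℝ (Fin (N + 1))) + (((i + 1 : ℕ) : ℝ) / n) • one
  have hg : ContMDiff (𝓡 N) 𝓘(ℝ, Fin n → Fin n → K) ∞ g := by
    have h1 : ContMDiff (𝓡 N) 𝓘(ℝ, EuclideanSpace ℝ (Fin (N + 1))) ∞
        (fun y => (h y : EuclideanSpace ℝ (Fin (N + 1)))) :=
      contMDiff_coe_sphere.comp hsm
    exact ((contMDiff_linearMap (ρ • Φ.toMatrix)).comp h1).add contMDiff_const
  refine IsSmoothEmbedding.of_comp hgr hg ?_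
  have hcomp : g ∘ grEmbedding ι i = projFun := by
    funext V
    simp only [g, Function.comp_apply]
    rw [hcoe, map_smul, smul_inv_smul₀ hρ.ne', Φ.toMatrix_ofMatrix_centeredProj hn]
    exact sub_add_cancel (proj V) _
  rw [hcomp]
  exact isSmoothEmbedding_projFun

theorem flagJoinIsSmoothSphere {N : ℕ} (hn : 1 ≤ n)
    (hN : N + 2 = n + n * (n - 1) / 2 * finrank ℝ K) : FlagJoinIsSmoothSphere K n N := by
  obtain ⟨Φ⟩ := nonempty_hermitianParametrization (K := K) hn (d := N + 1) hN
  -- The threshold is the real dimension of the matrix space, into which all the Grassmannians are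
  -- embedded at once by their projections.
  refine ⟨⟨finrank ℝ (Fin n → Fin n → K), fun M hM => ?_⟩,
    fun M ι hι => hι.hasStandardSphereStructure (by omega) Φ⟩
  obtain ⟨L, hL⟩ := exists_injective_linearMap_euclideanSpace hM
  exact ⟨fun _ V => L (projFun V), generalPosition_projFun hL,
    fun _ => isSmoothEmbedding_linearMap_comp_projFun hL⟩

end Sphere

end

end FlagJoin

theorem theorem3p3 (n : ℕ) (hn : 2 ≤ n) :
    FlagJoin.FlagJoinIsSmoothSphere ℝ n (n * (n - 1) / 2 + n - 2) ∧
    FlagJoin.FlagJoinIsSmoothSphere ℂ n (n * (n - 1) + n - 2) ∧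
    FlagJoin.FlagJoinIsSmoothSphere ℍ[ℝ] n (2 * (n * (n - 1)) + n - 2) := by
  -- Halving is exact, so the dimension `n + (n(n-1)/2) dim K` of the Hermitian matrices can be
  -- matched with each `N`; the offset 2 accounts for the trace condition and for passing to the
  -- sphere.
  have h2 : 2 * (n * (n - 1) / 2) = n * (n - 1) :=
    Nat.mul_div_cancel' (Nat.even_mul_pred_self n).two_dvd
  refine ⟨FlagJoin.flagJoinIsSmoothSphere (by omega) ?_,
    FlagJoin.flagJoinIsSmoothSphere (by omega) ?_, FlagJoin.flagJoinIsSmoothSphere (by omega) ?_⟩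
  · rw [finrank_self]
    omega
  · rw [Complex.finrank_real_complex]
    omega
  · rw [Quaternion.finrank_eq_four]
    omega
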